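/- Let $0<a\le b\le\tau$ be integers, $\delta=b-a$, let $q\ge\tau$ be a prime power and $\alpha\in\mathbb F_{q^2}\setminus\mathbb F_q$. For $i\le j$ write $[i:j]=\{i,\dots,j\}$, and let $M(I,J)$ be the submatrix of $M$ with rows in $I$ and columns in $J$ (indices start at $0$). Define the $u\times v$ matrix $P^a_{u,v}$ recursively by $P^a_{u,v}=[\,I_u\mid 0_{u\times a}\mid P^a_{u,v-u-a}\,]$ if $u+a<v$, $P^a_{u,v}=[\,I_u\mid 0_{u\times(v-u)}\,]$ if $u\le v\le u+a$, and $P^a_{u,v}=\begin{bmatrix}I_v\\ P^a_{u-v,v}\end{bmatrix}$ if $v<u$ (empty if $u=0$ or $v=0$). Given an $a\times(\tau+1-a)$ matrix $C$ over $\mathbb F_q$ all of whose square submatrices are nonsingular, define the $b\times(\tau+1+\delta)$ matrix $H$ over $\mathbb F_{q^2}$ by starting from the zero matrix and setting, in this order (blocks with an empty index set are skipped), $H([0:\delta-1],[0:\delta-1])=\alpha I_\delta$, $H([0:\delta-1],[b:\tau-1])=P^a_{\delta,\tau-b}$, $H([\delta:b-1],[0:a-1])=I_a$, $H([\delta:b-1],[a:\tau])=C$,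 $H(0,\tau)=\alpha$, $H([1:\delta],[\tau+1:\tau+\delta])=I_\delta$. Let $\mathcal C=\{c\in\mathbb F_{q^2}^{\,n}: Hc=0\}$, with $n=\tau+1+\delta$ and $k=n-b=\tau+1-a$. A *packet-level code* with parameters $(k,n)$ over a finite field maps a stream of message packets $u(t)$ of $k$ symbols, $t\in\mathbb Z$, to coded packets $x(t)=[u(t);p(t)]$ of $n$ symbols, where $p(t)$ depends only on $u(s)$, $s\le t$; its rate is $k/n$. It is an *$(a,b,\tau)$ streaming code* if, whenever the set of erased time indices meets each window of $\tau+1$ consecutive time indices either in a burst (a set of consecutive indices) of length at most $b$ or in at most $a$ indices, every $u(t)$ is determined by the non-erased $x(s)$ with $s\le t+\tau$. It is a *diagonal embedding* of $\mathcal C$ if $(x_0(t),x_1(t+1),\dots,x_{n-1}(t+n-1))\in\mathcal C$ for all message streams and all $t$. Then a matrix $C$ as above exists, and for every such $C$ and $\alpha$ the code $\mathcal C$ has dimension $k=\tau+1-a$ and satisfies, for codewords $(c_0,\dots,c_{n-1})$ of $\mathcal C$: * (B1) for every $t\in[0:\delta-1]$, $c_t$ is determined by the $c_i$ with $i\le\tau+t$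 and $i\notin[t:t+b-1]$; * (R1) for every $t\in[0:\delta-1]$ and every $A\subseteq[t+1:\tau+t]$ with $|A|=a-1$, $c_t$ is determined by the $c_i$ with $i\le\tau+t$ and $i\notin A\cup\{t\}$; * (B2) for every $t\in[\delta:\tau+1-a]$, the $c_i$ with $i\in[t:t+b-1]$ are determined by the remaining symbols; * (R2) for every $A\subseteq[\delta:\tau+\delta]$ with $|A|=a$, the $c_i$ with $i\in A$ are determined by the remaining symbols. Moreover there is exactly one packet-level code with parameters $(k,n)$ over $\mathbb F_{q^2}$ that is a diagonal embedding of $\mathcal C$. It is an $(a,b,\tau)$ streaming code of rate $\frac{\tau+1-a}{\tau+1-a+b}$, and this rate is optimal: no $(a,b,\tau)$ streaming code over any finite field has a larger rate. -/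

import Mathlib

/-- The `(i, j)` entry of the recursively defined `u × v` matrix `P^a_{u,v}` of zeros and ones:
* `P = [ I_u | 0_{u × a} | P^a_{u, v-u-a} ]` if `u + a < v`,
* `P = [ I_u | 0_{u × (v-u)} ]` if `u ≤ v ≤ u + a`,
* `P = [ I_v ; P^a_{u-v, v} ]` (stacked) if `v < u`.
For `u = 0` or `v = 0` the matrix has no entry and the value is a placeholder. -/
def pEntry (a u v i j : ℕ) : ℕ :=
  if u = 0 ∨ v = 0 then 0
  else if u + a < v then
    if j < u then (if i = j then 1 else 0)
    else if j < u + a then 0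
    else pEntry a u (v - u - a) i (j - u - a)
  else if u ≤ v then
    if j < u then (if i = j then 1 else 0)
    else 0
  else
    if i < v then (if i = j then 1 else 0)
    else pEntry a (u - v) v (i - v) j
termination_by u + v
decreasing_by all_goals omega

/-- The matrix `P^a_{u,v}` with entries `0, 1` in `R`. -/
def pMatrix (R : Type*) [NatCast R] (a u v : ℕ) : Matrix (Fin u) (Fin v) R :=
  Matrix.of fun i j => (pEntry a u v i j : R)

/-- Every square submatrix of `C` is nonsingular. -/
def AllMinorsNonzero {F : Type*} [CommRing F] {r s : ℕ} (C : Matrix (Fin r) (Fin s) F) : Prop :=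
  ∀ (m : ℕ) (f : Fin m → Fin r) (g : Fin m → Fin s),
    Function.Injective f → Function.Injective g → (C.submatrix f g).det ≠ 0

/-- The `b × (τ + 1 + δ)` parity-check matrix, `δ = b - a`. It is defined by successive
assignments; a later assignment is tested first here, so that it takes precedence:
* zero matrix;
* `H([0:δ-1],[0:δ-1]) = α I_δ`;
* `H([0:δ-1],[b:τ-1]) = P^a_{δ,τ-b}`;
* `H([δ:b-1],[0:a-1]) = I_a`;
* `H([δ:b-1],[a:τ]) = C`;
* `H(0,τ) = α` and `H([1:δ],[τ+1:τ+δ]) = I_δ`. -/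
def parityCheck {F K : Type*} [Field F] [Field K] [Algebra F K] (a b τ : ℕ) (α : K)
    (C : Matrix (Fin a) (Fin (τ + 1 - a)) F) :
    Matrix (Fin b) (Fin (τ + 1 + (b - a))) K :=
  Matrix.of fun i j =>
    if 1 ≤ i.val ∧ i.val ≤ b - a ∧ τ + 1 ≤ j.val then
      (if j.val = τ + i.val then 1 else 0)
    else if i.val = 0 ∧ j.val = τ then α
    else if hC : b - a ≤ i.val ∧ a ≤ j.val ∧ j.val ≤ τ then
      algebraMap F K (C ⟨i.val - (b - a), by omega⟩ ⟨j.val - a, by omega⟩)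
    else if b - a ≤ i.val ∧ j.val < a then
      (if i.val - (b - a) = j.val then 1 else 0)
    else if hP : i.val < b - a ∧ b ≤ j.val ∧ j.val < τ then
      pMatrix K a (b - a) (τ - b) ⟨i.val, hP.1⟩ ⟨j.val - b, by omega⟩
    else if i.val < b - a ∧ j.val < b - a then
      (if i.val = j.val then α else 0)
    else 0

/-- The scalar code with parity-check matrix `H`: all `c` with `H c = 0`. -/
def codeOfParityCheck {K : Type*} [Field K] {r n : ℕ} (H : Matrix (Fin r) (Fin n) K) :
    Submodule K (Fin n → K) :=
  LinearMap.ker H.mulVecLin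

/-- For codewords `c` of `𝒞`, the symbol `c_t` is a function of the symbols `c_i`, `i ∈ A`. -/
def Recoverable {K : Type*} [Field K] {n : ℕ} (𝒞 : Submodule K (Fin n → K)) (A : Set (Fin n))
    (t : Fin n) : Prop :=
  ∀ c ∈ 𝒞, ∀ c' ∈ 𝒞, (∀ i ∈ A, c i = c' i) → c t = c' t

/-- For `t ∈ [0:δ-1]`, the symbol `c_t` is recoverable from the erasure of the burst `[t:t+b-1]`
by accessing the non-erased symbols with index at most `τ + t`. -/
def PropB1 {K : Type*} [Field K] (a b τ : ℕ)
    (𝒞 : Submodule K (Fin (τ + 1 + (b - a)) → K)) : Prop :=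
  ∀ t : Fin (τ + 1 + (b - a)), t.val < b - a →
    Recoverable 𝒞 {i | i.val ≤ τ + t.val ∧ ¬ (t.val ≤ i.val ∧ i.val + 1 ≤ t.val + b)} t

/-- For `t ∈ [0:δ-1]`, the symbol `c_t` is recoverable from the erasure of `t` and of any `a - 1`
indices `A ⊆ [t+1:τ+t]` by accessing the non-erased symbols with index at most `τ + t`. -/
def PropR1 {K : Type*} [Field K] (a b τ : ℕ)
    (𝒞 : Submodule K (Fin (τ + 1 + (b - a)) → K)) : Prop :=
  ∀ t : Fin (τ + 1 + (b - a)), t.val < b - a →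
    ∀ A : Finset (Fin (τ + 1 + (b - a))), A.card = a - 1 →
      (∀ i ∈ A, t.val + 1 ≤ i.val ∧ i.val ≤ τ + t.val) →
      Recoverable 𝒞 {i | i.val ≤ τ + t.val ∧ i ≠ t ∧ i ∉ A} t

/-- For `t ∈ [δ:τ+1-a]`, the symbols with index in `[t:t+b-1]` are recoverable from all the
others. -/
def PropB2 {K : Type*} [Field K] (a b τ : ℕ)
    (𝒞 : Submodule K (Fin (τ + 1 + (b - a)) → K)) : Prop :=
  ∀ t : ℕ, b - a ≤ t → t ≤ τ + 1 - a →
    ∀ j : Fin (τ + 1 + (b - a)), t ≤ j.val → j.val + 1 ≤ t + b →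
      Recoverable 𝒞 {i | ¬ (t ≤ i.val ∧ i.val + 1 ≤ t + b)} j

/-- For `A ⊆ [δ:τ+δ]` with `|A| = a`, the symbols with index in `A` are recoverable from all the
others. -/
def PropR2 {K : Type*} [Field K] (a b τ : ℕ)
    (𝒞 : Submodule K (Fin (τ + 1 + (b - a)) → K)) : Prop :=
  ∀ A : Finset (Fin (τ + 1 + (b - a))), A.card = a → (∀ i ∈ A, b - a ≤ i.val) →
    ∀ j ∈ A, Recoverable 𝒞 {i | i ∉ A} j

/-- A packet-level code over the alphabet `K`: a causal encoder that turns a stream of message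
packets `u(t) ∈ K^k`, `t ∈ ℤ`, into coded packets `x(t) = [u(t) ; p(t)] ∈ K^n`, where the parity
packet `p(t)` depends only on `u(t)` and prior message packets. -/
@[ext]
structure PacketCode (K : Type*) (k n : ℕ) where
  /-- the first `k` symbols of a coded packet are those of the message packet -/
  k_le : k ≤ n
  /-- the encoder -/
  enc : (ℤ → Fin k → K) → ℤ → Fin n → K
  systematic : ∀ u t i, enc u t (Fin.castLE k_le i) = u t i
  causal : ∀ u v t, (∀ s ≤ t, u s = v s) → enc u t = enc v t

/-- The rate `k / n` of a packet-level code. -/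
def PacketCode.rate {K : Type*} {k n : ℕ} (_X : PacketCode K k n) : ℚ := (k : ℚ) / (n : ℚ)

/-- Permissible erasure patterns of the sliding-window channel with parameters `{a, b, τ}`: within
any window of `τ + 1` consecutive time units, either the erasures form a burst of length at most
`b`, or there are at most `a` erasures. -/
def PermissibleErasures (a b τ : ℕ) (E : Set ℤ) : Prop :=
  ∀ t : ℤ,
    (∃ (s : ℤ) (l : ℕ), l ≤ b ∧ E ∩ Set.Icc t (t + τ) = Set.Ico s (s + l)) ∨
    (E ∩ Set.Icc t (t + τ)).ncard ≤ a

/-- An `(a, b, τ)` streaming code: under every permissible erasure pattern `E`, each message packet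
`u(t)` is determined by the non-erased coded packets with index at most `t + τ`. -/
def PacketCode.IsStreaming {K : Type*} {k n : ℕ} (X : PacketCode K k n) (a b τ : ℕ) : Prop :=
  ∀ E : Set ℤ, PermissibleErasures a b τ E → ∀ (t : ℤ) (u v : ℤ → Fin k → K),
    (∀ s ≤ t + τ, s ∉ E → X.enc u s = X.enc v s) → u t = v t

/-- No `(a, b, τ)` streaming code, over any finite field and with packets of any size, has a larger
rate than `X`. -/
def PacketCode.HasOptimalRate {K : Type*} {k n : ℕ} (X : PacketCode K k n) (a b τ : ℕ) : Prop :=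
  ∀ (L : Type) [Field L] [Finite L] (k' n' : ℕ) (Y : PacketCode L k' n'),
    Y.IsStreaming a b τ → Y.rate ≤ X.rate

/-- `X` is obtained by diagonal embedding of the scalar code `𝒞`: for all message streams and all
`t`, the tuple `(x_0(t), x_1(t+1), …, x_{n-1}(t+n-1))` is a codeword of `𝒞`. -/
def PacketCode.IsDiagonalEmbedding {K : Type*} [Field K] {k n : ℕ} (X : PacketCode K k n)
    (𝒞 : Submodule K (Fin n → K)) : Prop :=
  ∀ (u : ℤ → Fin k → K) (t : ℤ), (fun i : Fin n => X.enc u (t + (i.val : ℤ)) i) ∈ 𝒞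

/-!
Write `δ = b - a`. The parity-check matrix has three ingredients: the rows of `[I_a | C]`, which
form an MDS code; the rows of `[0 | P | I]`, which take care of bursts; and an element `α ∉ F`, the
only kind of entry outside `F`. All recovery properties are shown in kernel form: a codeword whose
known symbols vanish also vanishes at the symbols to be recovered.

* Combinatorics of `P`. By induction along its recursive definition, the leading minors of `[P | I]`
  are nonzero (`pEntry_prefix`), and among any `u + a` consecutive columns of `[0 | P | I]` the rows
  of the matrix leave at most `a` nonzero entries (`exists_card_le_of_window`), which the `a` rows
  of `[I_a | C]` then kill (`AllMinorsNonzero.eq_zero_of_support`).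
* Role of `α`. Suppose that `c_j ≠ 0` and that in one check `α c_j` is the only term with a
  coefficient outside `F`. An `F`-linear functional `φ` with `φ (c_j) = 0` and `φ (α c_j) ≠ 0` maps
  the codeword to a vector over `F` that satisfies all checks over `F` and vanishes at `j`. These
  checks make it zero, which contradicts the one check with `α`. All statements on the checks over
  `F` are therefore proved for entries in an arbitrary `F`-module.
* Streaming. Each diagonal is a codeword of length `τ + 1 + δ`. Its first `δ` symbols are recovered
  one after the other by `PropB1` and `PropR1`; the others lie in a single window of length
  `τ + 1`, so that `PropB2` or `PropR2` applies. No other diagonal is needed.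
* Optimality. The periodic erasure of `b` out of `τ + 1 - a + b` time units is permissible, as a
  window that meets two bursts contains exactly `a` erasures. Counting messages and non-erased
  symbols over many periods bounds the rate (`PacketCode.IsStreaming.mul_le`).
* The matrix `C` is a Cauchy matrix with one of its points at infinity, which is why `q = τ` is
  enough (`det_extended_cauchy_ne_zero`).
-/

open Finset

/-! ### The matrices `P^a_{u,v}` -/

/-- The leading square block of `P^a_{u,v}` is an identity matrix. -/
lemma pEntry_eq_ite (a : ℕ) {u v i j : ℕ} (hiv : i < v) (hju : j < u) :
    pEntry a u v i j = if i = j then 1 else 0 := by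
  rw [pEntry]
  have h0 : ¬(u = 0 ∨ v = 0) := by omega
  simp only [h0, if_false, hiv, hju, if_true, ite_self]

section RowSums

variable {V : Type*} [AddCommGroup V]

lemma sum_pEntry_wide {a u v : ℕ} (h : u + a < v) {i : ℕ} (hi : i < u) (x : ℕ → V) :
    ∑ j ∈ range v, pEntry a u v i j • x j =
      x i + ∑ j ∈ range (v - u - a), pEntry a u (v - u - a) i j • x (u + a + j) := by
  have hp : ∀ j, pEntry a u v i j = if j < u then (if i = j then 1 else 0)
      else if j < u + a then 0 else pEntry a u (v - u - a) i (j - u - a) := by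
    intro j
    conv_lhs => rw [pEntry]
    have h0 : ¬(u = 0 ∨ v = 0) := by omega
    simp only [h0, h, if_false, if_true]
  have hv : v = (u + a) + (v - u - a) := by omega
  conv_lhs => rw [hv, sum_range_add, sum_range_add]
  rw [← hv]
  have h1 : ∑ j ∈ range u, pEntry a u v i j • x j = x i := by
    rw [sum_eq_single i]
    · simp [hp, hi]
    · intro j hj hji
      simp [hp, mem_range.1 hj, hji.symm]
    · simp [hi]
  have h2 : ∑ j ∈ range a, pEntry a u v i (u + j) • x (u + j) = 0 := by
    apply sum_eq_zero
    intro j hj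
    have := mem_range.1 hj
    simp [hp, this]
  rw [h1, h2, add_zero]
  congr 1
  apply sum_congr rfl
  intro j _
  rw [hp, if_neg (by omega), if_neg (by omega)]
  congr 2
  omega

lemma sum_pEntry_mid {a u v : ℕ} (h : u ≤ v) (h' : v ≤ u + a) {i : ℕ} (hi : i < u) (x : ℕ → V) :
    ∑ j ∈ range v, pEntry a u v i j • x j = x i := by
  have hp : ∀ j, pEntry a u v i j = if i = j then 1 else 0 := by
    intro j
    rw [pEntry]
    have h0 : ¬(u = 0 ∨ v = 0) := by omega
    have h1 : ¬ (u + a < v) := by omega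
    simp only [h0, h1, h, if_false, if_true]
    split_ifs <;> first | rfl | omega
  rw [sum_eq_single i]
  · simp [hp]
  · intro j _ hji
    simp [hp, hji.symm]
  · intro hi'
    simp at hi'
    omega

lemma sum_pEntry_of_lt {a u v : ℕ} (h : v < u) {i : ℕ} (hi : i < v) (x : ℕ → V) :
    ∑ j ∈ range v, pEntry a u v i j • x j = x i := by
  rw [sum_eq_single i]
  · simp [pEntry_eq_ite a hi (hi.trans h)]
  · intro j hj hji
    simp [pEntry_eq_ite a hi ((mem_range.1 hj).trans h), hji.symm]
  · simp [hi]

lemma sum_pEntry_add {a u v : ℕ} (h : v < u) (i : ℕ) (x : ℕ → V) :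
    ∑ j ∈ range v, pEntry a u v (v + i) j • x j =
      ∑ j ∈ range v, pEntry a (u - v) v i j • x j := by
  rcases Nat.eq_zero_or_pos v with rfl | hv
  · simp
  apply sum_congr rfl
  intro j _
  congr 1
  conv_lhs => rw [pEntry]
  have h0 : ¬(u = 0 ∨ v = 0) := by omega
  have h1 : ¬ (u + a < v) := by omega
  have h2 : ¬ (u ≤ v) := by omega
  have h3 : ¬ (v + i < v) := by omega
  simp only [h0, h1, h2, h3, if_false]
  congr 1
  omega

/-- The leading principal `t × t` minors of `[P^a_{u,v} | I_u]` are nonzero: the columns of `I_u`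
take care of the first `t - v` rows, and `x` is killed by the remaining ones. -/
lemma pEntry_prefix (a v : ℕ) (u : ℕ) : ∀ (t : ℕ) (x : ℕ → V), t ≤ u →
    (∀ j < v, t ≤ j → x j = 0) →
    (∀ i < t, t ≤ i + v → ∑ j ∈ range v, pEntry a u v i j • x j = 0) →
    ∀ j < v, x j = 0 := by
  induction u using Nat.strong_induction_on with
  | _ u ih =>
  intro t x ht hx h j hj
  by_cases htv : t ≤ v
  · by_cases hjt : t ≤ j
    · exact hx j hj hjt
    push Not at hjt
    have := h j hjt (by omega)
    rw [sum_eq_single j] at this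
    · simpa [pEntry_eq_ite a hj (hjt.trans_le ht)] using this
    · intro j' hj' hne
      by_cases hjt' : t ≤ j'
      · rw [hx j' (mem_range.1 hj') hjt', smul_zero]
      · rw [pEntry_eq_ite a hj (by omega), if_neg hne.symm, zero_smul]
    · intro hj'
      exact absurd (mem_range.2 hj) hj'
  · push Not at htv
    have hvu : v < u := by omega
    refine ih (u - v) (by omega) (t - v) x (by omega) ?_ ?_ j hj
    · intro j hj htj
      rw [← sum_pEntry_of_lt (a := a) hvu hj x]
      exact h j (by omega) (by omega)
    · intro i hi hiv
      rw [← sum_pEntry_add hvu]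
      exact h (v + i) (by omega) (by omega)

/-- In `[0_{u × a} | P^a_{u,v} | I_u]`, consider the `u + a` consecutive columns from the `w`-th on.
The last `w + u - v` of them (if any) lie in `I_u` and take care of as many leading rows; if `y` is
supported on the others and is killed by the remaining rows, it has at most `a` nonzero entries.
The columns of the last `I_u` do not appear in the statement. The induction is on the bound `N`. -/
lemma exists_card_le_of_window (a : ℕ) (N : ℕ) : ∀ (u v w : ℕ) (y : ℕ → V), u + v ≤ N → w ≤ v →
    (∀ j, y j ≠ 0 → w ≤ j ∧ j < w + u + a ∧ j < a + v) →
    (∀ i < u, w + u ≤ i + v → ∑ j ∈ range v, pEntry a u v i j • y (a + j) = 0) →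
    ∃ S : Finset ℕ, S.card ≤ a ∧ ∀ j, y j ≠ 0 → j ∈ S := by
  induction N using Nat.strong_induction_on with
  | _ N ih =>
  intro u v w y hN hw hy h
  rcases Nat.eq_zero_or_pos u with rfl | hu
  · refine ⟨Ico w (w + a), by simp, fun j hj => ?_⟩
    have := hy j hj
    simp only [mem_Ico]; omega
  rcases Nat.eq_zero_or_pos v with rfl | hv
  · refine ⟨range a, by simp, fun j hj => ?_⟩
    have := hy j hj
    simp only [mem_range]; omega
  by_cases hwide : u + a < v
  · have hrow : ∀ i < u, w + u ≤ i + v → y (a + i) +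
        ∑ j ∈ range (v - u - a), pEntry a u (v - u - a) i j • y (u + a + (a + j)) = 0 := by
      intro i hi hiv
      rw [← h i hi hiv, sum_pEntry_wide hwide hi (fun j => y (a + j))]
      congr 1
      refine sum_congr rfl fun j _ => ?_
      congr 2
      omega
    by_cases hwu : u + a ≤ w
    · -- the first period `[0 | I_u]` lies to the left of the window
      obtain ⟨S, hS, hSy⟩ := ih (N - 1) (by omega) u (v - u - a) (w - u - a)
        (fun j => y (u + a + j)) (by omega) (by omega)
        (fun j hj => by have := hy _ hj; omega)
        (fun i hi hiv => by
          have h1 := hrow i hi (by omega)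
          have h2 : y (a + i) = 0 := by
            by_contra h3
            have := hy _ h3
            omega
          rwa [h2, zero_add] at h1)
      refine ⟨S.image (u + a + ·), card_image_le.trans hS, fun j hj => ?_⟩
      have hj' := hy j hj
      refine mem_image.2 ⟨j - (u + a), hSy _ ?_, by omega⟩
      have : u + a + (j - (u + a)) = j := by omega
      simpa only [this] using hj
    · push Not at hwu
      -- the part of the window after this period is killed by the rows whose entry in `I_u` lies
      -- to the left of the window
      have hx : ∀ j < v - u - a, y (u + a + (a + j)) = 0 := by
        refine pEntry_prefix a (v - u - a) u (w - a) (fun j => y (u + a + (a + j))) (by omega)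
          (fun j hj hjw => ?_) (fun i hi hiv => ?_)
        · by_contra h3
          have := hy _ h3
          omega
        · have h1 := hrow i (by omega) (by omega)
          have h2 : y (a + i) = 0 := by
            by_contra h3
            have := hy _ h3
            omega
          rwa [h2, zero_add] at h1
      have hI : ∀ i < u, w ≤ a + i → y (a + i) = 0 := by
        intro i hi hwi
        have h1 := hrow i hi (by omega)
        rwa [sum_eq_zero (fun j hj => by rw [hx j (mem_range.1 hj), smul_zero]), add_zero] at h1
      refine ⟨Ico w a ∪ Ico (a + u) (a + u + min w a), ?_, fun j hj => ?_⟩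
      · refine (card_union_le _ _).trans ?_
        simp only [Nat.card_Ico]
        omega
      · have hj' := hy j hj
        simp only [mem_union, mem_Ico]
        by_contra hcon
        apply hj
        by_cases hju : j < a + u
        · have := hI (j - a) (by omega) (by omega)
          rwa [show a + (j - a) = j by omega] at this
        · have := hx (j - (u + a + a)) (by omega)
          rwa [show u + a + (a + (j - (u + a + a))) = j by omega] at this
  by_cases hmid : u ≤ v
  · have hI : ∀ i < u, w + u ≤ i + v → y (a + i) = 0 := by
      intro i hi hiv
      rw [← sum_pEntry_mid (a := a) hmid (by omega) hi (fun j => y (a + j))]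
      exact h i hi hiv
    refine ⟨Ico w (w + u - v + a) ∪ Ico (a + u) (min (w + u + a) (a + v)), ?_, fun j hj => ?_⟩
    · refine (card_union_le _ _).trans ?_
      simp only [Nat.card_Ico]
      omega
    · have hj' := hy j hj
      simp only [mem_union, mem_Ico]
      by_contra hcon
      apply hj
      have := hI (j - a) (by omega) (by omega)
      rwa [show a + (j - a) = j by omega] at this
  · push Not at hmid
    -- the rows of the top block `I_v` shorten the window to `(u - v) + a` columns
    refine ih (N - 1) (by omega) (u - v) v w y (by omega) hw (fun j hj => ?_) (fun i hi hiv => ?_)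
    · have hj' := hy j hj
      refine ⟨hj'.1, ?_, hj'.2.2⟩
      by_contra hcon
      apply hj
      have := h (j - a) (by omega) (by omega)
      rw [sum_pEntry_of_lt (a := a) hmid (i := j - a) (by omega) (fun j => y (a + j))] at this
      rwa [show a + (j - a) = j by omega] at this
    · rw [← sum_pEntry_add hmid i (fun j => y (a + j))]
      exact h (v + i) (by omega) (by omega)

end RowSums

/-! ### The matrix `[I_a | C]` -/

/-- A nonsingular matrix over `F` has trivial kernel on vectors with entries in an `F`-module. -/
lemma eq_zero_of_det_ne_zero {F V ι : Type*} [Field F] [AddCommGroup V] [Module F V] [Fintype ι]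
    [DecidableEq ι] (M : Matrix ι ι F) (hM : M.det ≠ 0) (y : ι → V)
    (h : ∀ i, ∑ j, M i j • y j = 0) : y = 0 := by
  funext k
  have h1 : ∑ i, M⁻¹ k i • ∑ j, M i j • y j = y k := by
    simp_rw [smul_sum, smul_smul]
    rw [sum_comm]
    simp_rw [← sum_smul, ← Matrix.mul_apply, Matrix.nonsing_inv_mul M (isUnit_iff_ne_zero.2 hM),
      Matrix.one_apply, ite_smul, one_smul, zero_smul]
    simp
  rw [← h1]
  simp [h]

/-- The code with parity-check matrix `[I | C]` is MDS, also after deletion of rows: a vector that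
is killed by the rows in `R` and has at most `|R|` nonzero entries, not counting those in the
identity part at rows outside `R`, vanishes on `C`. -/
lemma AllMinorsNonzero.eq_zero_of_card_le {F V : Type*} [Field F] [AddCommGroup V] [Module F V]
    {r s : ℕ} {C : Matrix (Fin r) (Fin s) F} (hC : AllMinorsNonzero C) (R : Finset (Fin r))
    (x : Fin r → V) (y : Fin s → V) (h : ∀ i ∈ R, x i + ∑ j, C i j • y j = 0)
    [DecidablePred fun i => x i ≠ 0] [DecidablePred fun j => y j ≠ 0]
    (hc : #{i ∈ R | x i ≠ 0} + #{j | y j ≠ 0} ≤ #R) : y = 0 := by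
  classical
  set Y : Finset (Fin s) := {j | y j ≠ 0} with hY
  have hR := card_filter_add_card_filter_not (s := R) (fun i => x i ≠ 0)
  obtain ⟨R', hR', hcard⟩ := exists_subset_card_eq
    (s := R.filter fun i => ¬ x i ≠ 0) (n := #Y) (by omega)
  have key := eq_zero_of_det_ne_zero _
    (hC #Y (R'.orderEmbOfFin hcard) (Y.orderEmbOfFin rfl) (R'.orderEmbOfFin hcard).injective
      (Y.orderEmbOfFin rfl).injective) (fun k => y (Y.orderEmbOfFin rfl k)) (by
    intro i
    have hi := mem_filter.1 (hR' (R'.orderEmbOfFin_mem hcard i))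
    have hx : x (R'.orderEmbOfFin hcard i) = 0 := not_not.1 hi.2
    have h1 := h _ hi.1
    rw [hx, zero_add, ← sum_filter_of_ne (p := fun j => y j ≠ 0)
      (fun j _ hj hy => hj (by rw [hy, smul_zero])), ← hY,
      ← Finset.sum_coe_sort Y] at h1
    rw [← h1]
    exact Fintype.sum_equiv (Y.orderIsoOfFin rfl).toEquiv _ _ (fun k => rfl))
  funext j
  by_contra hj
  have hjY : j ∈ Y := by simpa [hY] using hj
  have := congrFun key ((Y.orderIsoOfFin rfl).symm ⟨j, hjY⟩)
  apply hj
  have e : Y.orderEmbOfFin rfl ((Y.orderIsoOfFin rfl).symm ⟨j, hjY⟩) = j := by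
    rw [← coe_orderIsoOfFin_apply, OrderIso.apply_symm_apply]
  simpa only [e, Pi.zero_apply] using this

/-- The MDS property of `[I_a | C]` without its first `l` rows and columns, for vectors indexed by
the natural numbers. -/
lemma AllMinorsNonzero.eq_zero_of_support {F V : Type*} [Field F] [AddCommGroup V] [Module F V]
    {a τ : ℕ} (haτ : a ≤ τ) {C : Matrix (Fin a) (Fin (τ + 1 - a)) F} (hC : AllMinorsNonzero C)
    {l : ℕ} (hl : l ≤ a) (e : ℕ → V) (S : Finset ℕ) (hS : #S ≤ a - l)
    (he : ∀ j, l ≤ j → j ≤ τ → j ∉ S → e j = 0)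
    (h : ∀ r : Fin a, l ≤ r.val → e r + ∑ j, C r j • e (a + j) = 0) :
    ∀ j, l ≤ j → j ≤ τ → e j = 0 := by
  classical
  have hcard : #{i : Fin a | l ≤ i.val} = a - l := by
    have : (({i : Fin a | l ≤ i.val} : Finset (Fin a)).map Fin.valEmbedding) = Ico l a := by
      ext j
      simp only [mem_map, mem_filter, mem_univ, true_and, Fin.valEmbedding_apply, mem_Ico]
      exact ⟨by rintro ⟨i, hi, rfl⟩; exact ⟨hi, i.2⟩, fun hj => ⟨⟨j, hj.2⟩, hj.1, rfl⟩⟩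
    rw [← card_map, this, Nat.card_Ico]
  have hy := hC.eq_zero_of_card_le ({i : Fin a | l ≤ i.val} : Finset (Fin a)) (fun i => e i)
    (fun j => e (a + j)) (fun i hi => h i (by simpa using hi)) (by
      rw [hcard]
      refine le_trans ?_ hS
      rw [← card_map Fin.valEmbedding,
        ← card_map (s := {j : Fin (τ + 1 - a) | e (a + j) ≠ 0})
          (Fin.valEmbedding.trans (addLeftEmbedding a)), ← card_union_of_disjoint]
      · refine card_le_card fun j hj => ?_
        simp only [mem_union, mem_map, mem_filter, mem_univ, true_and, Fin.valEmbedding_apply,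
          Function.Embedding.trans_apply, addLeftEmbedding_apply] at hj
        rcases hj with ⟨i, ⟨hi, hne⟩, rfl⟩ | ⟨i, hne, rfl⟩
        · by_contra hS'
          exact hne (he _ hi (by omega) hS')
        · by_contra hS'
          exact hne (he _ (by omega) (by omega) hS')
      · rw [disjoint_left]
        simp only [mem_map, Fin.valEmbedding_apply, Function.Embedding.trans_apply,
          addLeftEmbedding_apply]
        rintro j ⟨i, -, rfl⟩ ⟨i', -, h'⟩
        omega)
  intro j hlj hjτ
  by_cases hja : j < a
  · have h1 := h ⟨j, hja⟩ hlj
    rwa [sum_eq_zero (fun k _ => by rw [show e (a + k) = 0 from congrFun hy k, smul_zero]),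
      add_zero] at h1
  · have := congrFun hy ⟨j - a, by omega⟩
    simpa only [show a + (j - a) = j by omega, Pi.zero_apply] using this

/-- If `α ∉ F` then `α x` is not an `F`-multiple of `x ≠ 0`; an `F`-linear functional detects it. -/
lemma exists_functional {F K : Type*} [Field F] [Field K] [Algebra F K] {α : K}
    (hα : α ∉ Set.range (algebraMap F K)) {x : K} (hx : x ≠ 0) :
    ∃ φ : K →ₗ[F] F, φ x = 0 ∧ φ (α * x) ≠ 0 := by
  have hmem : α * x ∉ Submodule.span F {x} := by
    rw [Submodule.mem_span_singleton]
    rintro ⟨c, hc⟩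
    rw [Algebra.smul_def] at hc
    exact hα ⟨c, mul_right_cancel₀ hx hc⟩
  obtain ⟨φ, hφ, hle⟩ := Submodule.exists_le_ker_of_notMem hmem
  exact ⟨φ, hle (Submodule.mem_span_singleton_self x), hφ⟩

/-! ### The parity checks as equations -/

/-- The extension of a finite vector by zero to all natural indices. -/
def zeroExtend {V : Type*} [Zero V] {n : ℕ} (d : Fin n → V) (j : ℕ) : V :=
  if h : j < n then d ⟨j, h⟩ else 0

lemma zeroExtend_coe {V : Type*} [Zero V] {n : ℕ} (d : Fin n → V) (j : Fin n) :
    zeroExtend d j = d j := by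
  simp [zeroExtend]

lemma zeroExtend_of_lt {V : Type*} [Zero V] {n : ℕ} (d : Fin n → V) {j : ℕ} (h : j < n) :
    zeroExtend d j = d ⟨j, h⟩ :=
  dif_pos h

section Rows

variable {F K : Type*} [Field F] [Field K] [Algebra F K] {a b τ : ℕ} {α : K}
  {C : Matrix (Fin a) (Fin (τ + 1 - a)) F} {d : Fin (τ + 1 + (b - a)) → K}

lemma parityCheck_of_top_left (hbτ : b ≤ τ) {i : Fin b} {j : Fin (τ + 1 + (b - a))}
    (hi : i.val < b - a) (hj : j.val < b) :
    parityCheck a b τ α C i j = if i.val = j.val then α else 0 := by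
  simp only [parityCheck, Matrix.of_apply]
  rw [if_neg (by omega), if_neg (by omega), dif_neg (by omega), if_neg (by omega),
    dif_neg (by omega)]
  split_ifs <;> first | rfl | omega

lemma parityCheck_of_top_middle {i : Fin b} {j : Fin (τ + 1 + (b - a))}
    (hi : i.val < b - a) (hj : b ≤ j.val) (hjτ : j.val < τ) :
    parityCheck a b τ α C i j = (pEntry a (b - a) (τ - b) i.val (j.val - b) : K) := by
  simp only [parityCheck, Matrix.of_apply]
  rw [if_neg (by omega), if_neg (by omega), dif_neg (by omega), if_neg (by omega),
    dif_pos (by omega)]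
  rfl

lemma parityCheck_of_top_last (hbτ : b ≤ τ) {i : Fin b} {j : Fin (τ + 1 + (b - a))}
    (hi : i.val < b - a) (hj : j.val = τ) :
    parityCheck a b τ α C i j = if i.val = 0 then α else 0 := by
  simp only [parityCheck, Matrix.of_apply]
  by_cases h0 : i.val = 0
  · rw [if_neg (by omega), if_pos ⟨h0, hj⟩, if_pos h0]
  · rw [if_neg (by omega), if_neg (by omega), dif_neg (by omega), if_neg (by omega),
      dif_neg (by omega), if_neg (by omega), if_neg h0]

lemma parityCheck_of_lt (haτ : a ≤ τ) (hbτ : b ≤ τ) {i : Fin b} {j : Fin (τ + 1 + (b - a))}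
    (hj : τ < j.val) :
    parityCheck a b τ α C i j = if j.val = τ + i.val then 1 else 0 := by
  simp only [parityCheck, Matrix.of_apply]
  by_cases h1 : 1 ≤ i.val ∧ i.val ≤ b - a ∧ τ + 1 ≤ j.val
  · rw [if_pos h1]
  · rw [if_neg h1, if_neg (by omega), dif_neg (by omega), if_neg (by omega),
      dif_neg (by omega), if_neg (by omega), if_neg (by omega)]

lemma parityCheck_of_bottom_left (haτ : a ≤ τ) {i : Fin b} {j : Fin (τ + 1 + (b - a))}
    (hi : b - a ≤ i.val) (hj : j.val < a) :
    parityCheck a b τ α C i j = if i.val - (b - a) = j.val then 1 else 0 := by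
  simp only [parityCheck, Matrix.of_apply]
  rw [if_neg (by omega), if_neg (by omega), dif_neg (by omega), if_pos (by omega)]

lemma parityCheck_of_bottom_right {i : Fin b} {r : Fin a} {j : Fin (τ + 1 + (b - a))}
    {s : Fin (τ + 1 - a)} (hi : i.val = b - a + r.val) (hj : j.val = a + s.val)
    (h : i.val ≠ 0 ∨ j.val ≠ τ) :
    parityCheck a b τ α C i j = algebraMap F K (C r s) := by
  simp only [parityCheck, Matrix.of_apply]
  rw [if_neg (by omega), if_neg (by omega), dif_pos (by omega)]
  congr 2 <;> ext <;> simp only <;> omega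

lemma parityCheck_of_corner {i : Fin b} {j : Fin (τ + 1 + (b - a))} (hi : i.val = 0)
    (hj : j.val = τ) : parityCheck a b τ α C i j = α := by
  simp only [parityCheck, Matrix.of_apply]
  rw [if_neg (by omega), if_pos ⟨hi, hj⟩]

lemma sum_zeroExtend_of_mem
    (hd : d ∈ codeOfParityCheck (parityCheck a b τ α C)) (i : Fin b) :
    ∑ j ∈ range (τ + 1 + (b - a)), zeroExtend (parityCheck a b τ α C i) j * zeroExtend d j = 0 := by
  have h : ∑ j, parityCheck a b τ α C i j * d j = 0 := congrFun (LinearMap.mem_ker.1 hd) i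
  rw [← h, ← Fin.sum_univ_eq_sum_range (fun j => zeroExtend (parityCheck a b τ α C i) j *
    zeroExtend d j)]
  simp only [zeroExtend_coe]

lemma top_row (hbτ : b ≤ τ) (hd : d ∈ codeOfParityCheck (parityCheck a b τ α C)) {i : ℕ}
    (hi : i < b - a) :
    α * zeroExtend d i + ∑ j ∈ range (τ - b), pEntry a (b - a) (τ - b) i j • zeroExtend d (b + j)
      + (if i = 0 then α else 1) * zeroExtend d (τ + i) = 0 := by
  have h := sum_zeroExtend_of_mem hd ⟨i, by omega⟩
  rw [show range (τ + 1 + (b - a)) = range (b + (τ - b) + 1 + (b - a)) by congr 1; omega,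
    sum_range_add, sum_range_succ, sum_range_add, show b + (τ - b) = τ by omega] at h
  refine Eq.trans ?_ h
  have h1 : ∑ j ∈ range b, zeroExtend (parityCheck a b τ α C ⟨i, by omega⟩) j * zeroExtend d j
      = α * zeroExtend d i := by
    rw [sum_eq_single i]
    · rw [zeroExtend_of_lt _ (by omega), parityCheck_of_top_left hbτ hi (by simp only; omega),
        if_pos rfl]
    · intro j hj hji
      have := mem_range.1 hj
      rw [zeroExtend_of_lt _ (by omega), parityCheck_of_top_left hbτ hi this,
        if_neg (Ne.symm hji), zero_mul]
    · intro hi'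
      simp at hi'
      omega
  have h2 : ∑ j ∈ range (τ - b), zeroExtend (parityCheck a b τ α C ⟨i, by omega⟩) (b + j) *
      zeroExtend d (b + j) =
      ∑ j ∈ range (τ - b), pEntry a (b - a) (τ - b) i j • zeroExtend d (b + j) := by
    apply sum_congr rfl
    intro j hj
    have := mem_range.1 hj
    rw [nsmul_eq_mul, zeroExtend_of_lt (parityCheck a b τ α C _) (by omega),
      parityCheck_of_top_middle hi (by simp only; omega) (by simp only; omega)]
    simp only [Nat.add_sub_cancel_left]
  rw [h1, h2, add_assoc (_ + _)]
  congr 1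
  rw [zeroExtend_of_lt (parityCheck a b τ α C _) (j := τ) (by omega),
    parityCheck_of_top_last hbτ hi rfl]
  have h3 : ∀ j ∈ range (b - a), zeroExtend (parityCheck a b τ α C ⟨i, by omega⟩) (τ + 1 + j) =
      if j + 1 = i then 1 else 0 := by
    intro j hj
    have := mem_range.1 hj
    rw [zeroExtend_of_lt _ (by omega), parityCheck_of_lt (by omega) hbτ (by simp only; omega)]
    split_ifs with h1 h2 h2 <;> simp only at h1 <;> first | rfl | omega
  rcases Nat.eq_zero_or_pos i with rfl | hpos
  · rw [sum_eq_zero fun j hj => by rw [h3 j hj, if_neg (by omega), zero_mul], add_zero, add_zero,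
      if_pos rfl, if_pos rfl]
  · rw [if_neg hpos.ne', if_neg (by simp only; omega), zero_mul, zero_add,
      sum_eq_single_of_mem (i - 1) (mem_range.2 (by omega)), h3 _ (mem_range.2 (by omega)),
      if_pos (by omega), show τ + 1 + (i - 1) = τ + i by omega]
    intro j hj hji
    rw [h3 j hj, if_neg (by omega), zero_mul]

lemma sum_range_bottom_left (haτ : a ≤ τ) (hab : a ≤ b) (r : Fin a) :
    ∑ j ∈ range a, zeroExtend (parityCheck a b τ α C ⟨b - a + r, by omega⟩) j *
      zeroExtend d j = zeroExtend d r := by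
  have h : ∀ j ∈ range a, zeroExtend (parityCheck a b τ α C ⟨b - a + r, by omega⟩) j =
      if r.val = j then 1 else 0 := by
    intro j hj
    have := mem_range.1 hj
    rw [zeroExtend_of_lt _ (by omega), parityCheck_of_bottom_left haτ (by simp) this]
    simp only [Nat.add_sub_cancel_left]
  rw [sum_eq_single_of_mem r.val (mem_range.2 r.2), h _ (mem_range.2 r.2), if_pos rfl, one_mul]
  intro j hj hjr
  rw [h j hj, if_neg (Ne.symm hjr), zero_mul]

lemma bottom_row (hab : a ≤ b) (hbτ : b ≤ τ)
    (hd : d ∈ codeOfParityCheck (parityCheck a b τ α C)) (r : Fin a) (hr : r.val ≠ 0 ∨ a < b) :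
    zeroExtend d r + ∑ j, C r j • zeroExtend d (a + j)
      + (if r.val = 0 then zeroExtend d (τ + (b - a)) else 0) = 0 := by
  have hra := r.2
  have h := sum_zeroExtend_of_mem hd ⟨b - a + r, by omega⟩
  rw [show range (τ + 1 + (b - a)) = range (a + (τ + 1 - a) + (b - a)) by congr 1; omega,
    sum_range_add, sum_range_add, show a + (τ + 1 - a) = τ + 1 by omega,
    sum_range_bottom_left (by omega) hab] at h
  refine Eq.trans ?_ h
  have h2 : ∑ j ∈ range (τ + 1 - a), zeroExtend (parityCheck a b τ α C ⟨b - a + r, by omega⟩)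
      (a + j) * zeroExtend d (a + j) = ∑ j, C r j • zeroExtend d (a + j) := by
    rw [← Fin.sum_univ_eq_sum_range (fun j => zeroExtend (parityCheck a b τ α C
      ⟨b - a + r, by omega⟩) (a + j) * zeroExtend d (a + j))]
    apply sum_congr rfl
    intro j _
    rw [Algebra.smul_def, zeroExtend_of_lt (parityCheck a b τ α C _) (by omega),
      parityCheck_of_bottom_right (r := r) (s := j) rfl rfl (Or.inl (by simp only; omega))]
  have h3 : ∀ j ∈ range (b - a), zeroExtend (parityCheck a b τ α C ⟨b - a + r, by omega⟩)
      (τ + 1 + j) = if j + 1 = b - a + r then 1 else 0 := by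
    intro j hj
    have := mem_range.1 hj
    rw [zeroExtend_of_lt _ (by omega), parityCheck_of_lt (by omega) hbτ (by simp only; omega)]
    split_ifs with h1 h2 h2 <;> simp only at h1 <;> first | rfl | omega
  rw [h2]
  congr 1
  split_ifs with h0
  · rw [sum_eq_single_of_mem (b - a - 1) (mem_range.2 (by omega)), h3 _ (mem_range.2 (by omega)),
      if_pos (by omega), one_mul, show τ + 1 + (b - a - 1) = τ + (b - a) by omega]
    intro j hj hjr
    have := mem_range.1 hj
    rw [h3 j hj, if_neg (by omega), zero_mul]
  · rw [sum_eq_zero]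
    intro j hj
    have := mem_range.1 hj
    rw [h3 j hj, if_neg (by omega), zero_mul]

/-- For `b = a` the corner entry of `C` is overwritten by `α`. -/
lemma corner_row (ha : 0 < a) (hab : a = b) (hbτ : b ≤ τ)
    (hd : d ∈ codeOfParityCheck (parityCheck a b τ α C)) :
    zeroExtend d 0 + ∑ j, C ⟨0, ha⟩ j • (if a + j.val = τ then 0 else zeroExtend d (a + j))
      + α * zeroExtend d τ = 0 := by
  have h := sum_zeroExtend_of_mem hd ⟨b - a + 0, by omega⟩
  rw [show range (τ + 1 + (b - a)) = range (a + (τ + 1 - a)) by congr 1; omega,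
    sum_range_add, sum_range_bottom_left (by omega) hab.le ⟨0, ha⟩] at h
  refine Eq.trans ?_ h
  rw [add_assoc]
  congr 1
  have hlast : α * zeroExtend d τ = ∑ j : Fin (τ + 1 - a),
      if a + j.val = τ then α * zeroExtend d (a + j) else 0 := by
    rw [sum_eq_single_of_mem ⟨τ - a, by omega⟩ (mem_univ _), if_pos (by simp only; omega)]
    · congr 2
      simp only; omega
    · intro j _ hj
      rw [if_neg]
      intro h'
      apply hj
      ext
      simp only; omega
  rw [hlast, ← sum_add_distrib, ← Fin.sum_univ_eq_sum_range (fun j => zeroExtend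
    (parityCheck a b τ α C ⟨b - a + 0, by omega⟩) (a + j) * zeroExtend d (a + j))]
  apply sum_congr rfl
  intro j _
  rw [zeroExtend_of_lt (parityCheck a b τ α C _) (by omega)]
  by_cases hj : a + j.val = τ
  · rw [if_pos hj, if_pos hj, smul_zero, zero_add,
      parityCheck_of_corner (by simp only; omega) hj]
  · rw [if_neg hj, if_neg hj, add_zero, Algebra.smul_def,
      parityCheck_of_bottom_right (r := ⟨0, ha⟩) (s := j) rfl rfl (Or.inr hj)]

end Rows

/-! ### Recovery from erasures -/

section Recovery

variable {F K : Type*} [Field F] [Field K] [Algebra F K] {a b τ : ℕ} {α : K}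
  {C : Matrix (Fin a) (Fin (τ + 1 - a)) F} {d : Fin (τ + 1 + (b - a)) → K}

lemma ne_zero_of_notMem_range (hα : α ∉ Set.range (algebraMap F K)) : α ≠ 0 := by
  rintro rfl
  exact hα ⟨0, map_zero _⟩

lemma zeroExtend_of_le {j : ℕ} (hj : τ + 1 + (b - a) ≤ j) : zeroExtend d j = 0 :=
  dif_neg (by omega)

/-- The lower rows of `[I_a | C]`, which have no entry in the last column of the parity-check
matrix. -/
lemma lower_row (hab : a ≤ b) (hbτ : b ≤ τ)
    (hd : d ∈ codeOfParityCheck (parityCheck a b τ α C)) (r : Fin a) (hr : 1 ≤ r.val) :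
    zeroExtend d r + ∑ j, C r j • zeroExtend d (a + j) = 0 := by
  have h := bottom_row hab hbτ hd r (Or.inl (by omega))
  rwa [if_neg (by omega), add_zero] at h

/-- Checks with coefficients in `F` are preserved by `F`-linear maps of the entries. -/
lemma row_map {V W : Type*} [AddCommGroup V] [Module F V] [AddCommGroup W] [Module F W]
    (φ : V →ₗ[F] W) {e : ℕ → V} {r : Fin a}
    (h : e r + ∑ j, C r j • e (a + j) = 0) : φ (e r) + ∑ j, C r j • φ (e (a + j)) = 0 := by
  simpa only [map_add, map_sum, map_smul, map_zero] using congrArg φ h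

/-- A codeword that vanishes on the first `τ + 1` symbols is zero. -/
lemma zeroExtend_eq_zero_of_le (ha : 0 < a) (hab : a ≤ b) (hbτ : b ≤ τ)
    (hd : d ∈ codeOfParityCheck (parityCheck a b τ α C)) (h : ∀ j ≤ τ, zeroExtend d j = 0) (j : ℕ) :
    zeroExtend d j = 0 := by
  by_cases hj : j ≤ τ
  · exact h j hj
  by_cases hn : τ + 1 + (b - a) ≤ j
  · exact zeroExtend_of_le hn
  obtain ⟨i, rfl⟩ : ∃ i, j = τ + i := ⟨j - τ, by omega⟩
  by_cases hi : i < b - a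
  · have h1 := top_row hbτ hd hi
    rw [h i (by omega), sum_eq_zero, if_neg (by omega)] at h1
    · simpa using h1
    · intro k hk
      have := mem_range.1 hk
      rw [h _ (by omega), smul_zero]
  · obtain rfl : i = b - a := by omega
    have h1 := bottom_row hab hbτ hd ⟨0, ha⟩ (Or.inr (by omega))
    rw [if_pos rfl, h _ (by simp), sum_eq_zero] at h1
    · simpa using h1
    · intro k _
      rw [h _ (by omega), smul_zero]

/-- The checks before the `t`-th recover the symbols with index in `[b : τ-1]`, by the leading minors
of `[P | I]`; then check `t` gives `c_t`. -/
lemma eq_zero_of_burst_of_lt (hα : α ∉ Set.range (algebraMap F K)) (hbτ : b ≤ τ)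
    (hd : d ∈ codeOfParityCheck (parityCheck a b τ α C)) {t : ℕ} (ht : t < b - a)
    (h : ∀ i ≤ τ + t, ¬ (t ≤ i ∧ i + 1 ≤ t + b) → zeroExtend d i = 0) :
    zeroExtend d t = 0 := by
  have hx : ∀ j < τ - b, zeroExtend d (b + j) = 0 := by
    refine pEntry_prefix a (τ - b) (b - a) t (fun j => zeroExtend d (b + j)) ht.le
      (fun j hj htj => h _ (by omega) (by omega)) (fun i hi hiv => ?_)
    have h1 := top_row hbτ hd (hi.trans ht)
    rwa [h i (by omega) (by omega), h (τ + i) (by omega) (by omega), mul_zero, mul_zero, zero_add,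
      add_zero] at h1
  have h1 := top_row hbτ hd ht
  rw [sum_eq_zero fun j hj => by rw [hx j (mem_range.1 hj), smul_zero],
    h (τ + t) (by omega) (by omega), mul_zero, add_zero, add_zero] at h1
  exact (mul_eq_zero.1 h1).resolve_left (ne_zero_of_notMem_range hα)

/-- The last `a - 1` rows of `[I_a | C]`, which do not meet the symbols with index beyond `τ`, and
check `t`, in which only `c_t` has a coefficient outside `F`, suffice to recover `c_t`. -/
lemma eq_zero_of_card_of_lt (hα : α ∉ Set.range (algebraMap F K)) (hC : AllMinorsNonzero C)
    (ha : 0 < a) (hab : a ≤ b) (hbτ : b ≤ τ)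
    (hd : d ∈ codeOfParityCheck (parityCheck a b τ α C)) {t : ℕ} (ht : t < b - a)
    {S : Finset ℕ} (hS : #S ≤ a - 1) (hSt : ∀ i ∈ S, t < i)
    (h : ∀ i ≤ τ + t, i ≠ t → i ∉ S → zeroExtend d i = 0) :
    zeroExtend d t = 0 := by
  have haτ : a ≤ τ := hab.trans hbτ
  have hlow := lower_row hab hbτ hd
  rcases Nat.eq_zero_or_pos t with rfl | ht0
  · have h0 := hC.eq_zero_of_support haτ ha (zeroExtend d) S hS
      (fun j hj hjτ hjS => h j (by omega) (by omega) hjS) hlow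
    have h1 := top_row hbτ hd ht
    rw [sum_eq_zero, add_zero, h0 (τ + 0) (by omega) (by omega), mul_zero, add_zero] at h1
    · exact (mul_eq_zero.1 h1).resolve_left (ne_zero_of_notMem_range hα)
    · intro j hj
      have := mem_range.1 hj
      rw [h0 _ (by omega) (by omega), smul_zero]
  by_cases hmem : τ + t ∈ S
  · -- only `a - 1` of the erased columns meet the rows of `[I_a | C]`
    refine hC.eq_zero_of_support haτ ha (zeroExtend d) (insert t (S.erase (τ + t))) ?_ ?_ hlow t ht0
      (by omega)
    · refine (card_insert_le _ _).trans ?_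
      have := card_erase_add_one hmem
      omega
    · intro j hj hjτ hjS
      simp only [mem_insert, mem_erase, not_or, not_and] at hjS
      exact h j (by omega) hjS.1 (hjS.2 (by omega))
  · by_contra hne
    -- `φ` turns the checks over `F` into checks that do not see `c_t`, but check `t` does
    obtain ⟨φ, hφ, hφα⟩ := exists_functional hα hne
    have h0 := hC.eq_zero_of_support haτ ha (fun j => φ (zeroExtend d j)) S hS
      (fun j hj hjτ hjS => by
        by_cases hjt : j = t
        · rw [hjt, hφ]
        · rw [h j (by omega) hjt hjS, map_zero])
      (fun r hr => row_map φ (hlow r hr))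
    have h1 := congrArg φ (top_row hbτ hd ht)
    rw [h (τ + t) le_rfl (by omega) hmem, mul_zero, add_zero, map_add, map_sum, map_zero,
      sum_eq_zero, add_zero] at h1
    · exact hφα h1
    · intro j hj
      have := mem_range.1 hj
      rw [map_nsmul, h0 _ (by omega) (by omega), smul_zero]

/-- For `b = a` the parity-check matrix `[I_a | C]` with corner entry `α` is still that of an MDS
code: a minor that contains the corner is `α` times a minor of `[I_a | C]` plus an element of `F`. -/
lemma eq_zero_of_card_of_eq (hα : α ∉ Set.range (algebraMap F K)) (hC : AllMinorsNonzero C)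
    (ha : 0 < a) (hab : a = b) (hbτ : b ≤ τ)
    (hd : d ∈ codeOfParityCheck (parityCheck a b τ α C)) {S : Finset ℕ} (hS : #S ≤ a)
    (h : ∀ i, i ∉ S → zeroExtend d i = 0) (i : ℕ) : zeroExtend d i = 0 := by
  have haτ : a ≤ τ := hab.le.trans hbτ
  have hlow := lower_row hab.le hbτ hd
  have hcor := corner_row ha hab hbτ hd
  have hlast : zeroExtend d τ = 0 := by
    by_contra hne
    have hτS : τ ∈ S := by
      by_contra h'
      exact hne (h _ h')
    by_cases h0S : 0 ∈ S
    · refine hne (hC.eq_zero_of_support haτ ha (zeroExtend d) (S.erase 0) ?_ ?_ hlow τ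
        (by omega) le_rfl)
      · have := card_erase_add_one h0S
        omega
      · intro j hj _ hjS
        simp only [mem_erase, not_and] at hjS
        exact h j (hjS (by omega))
    · obtain ⟨φ, hφ, hφα⟩ := exists_functional hα hne
      have h0 := hC.eq_zero_of_support haτ ha (fun j => φ (zeroExtend d j)) (S.erase τ)
        (by have := card_erase_add_one hτS; omega)
        (fun j hj hjτ hjS => by
          by_cases hjt : j = τ
          · rw [hjt, hφ]
          · simp only [mem_erase, not_and] at hjS
            rw [h j (hjS hjt), map_zero])
        (fun r hr => row_map φ (hlow r hr))
      have h1 := congrArg φ hcor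
      rw [h 0 h0S, zero_add, map_add, map_sum, map_zero, sum_eq_zero, zero_add] at h1
      · exact hφα h1
      · intro j _
        rw [map_smul]
        split_ifs
        · rw [map_zero, smul_zero]
        · rw [h0 _ (by omega) (by omega), smul_zero]
  refine zeroExtend_eq_zero_of_le ha hab.le hbτ hd (fun j hj => ?_) i
  refine hC.eq_zero_of_support haτ (Nat.zero_le a) (zeroExtend d) S hS (fun j _ _ hj => h j hj)
    (fun r _ => ?_) j (Nat.zero_le j) hj
  by_cases hr : 1 ≤ r.val
  · exact hlow r hr
  · obtain rfl : r = ⟨0, ha⟩ := Fin.ext (by simp only; omega)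
    rw [hlast, mul_zero, add_zero] at hcor
    rw [← hcor]
    congr 1
    refine sum_congr rfl fun j _ => ?_
    split_ifs with hj
    · rw [hj, hlast]
    · rfl

/-- For `b > a` already `[I_a | C]`, without its first row if the last symbol is erased, recovers
the erased symbols among the first `τ + 1`. -/
lemma eq_zero_of_card (hα : α ∉ Set.range (algebraMap F K)) (hC : AllMinorsNonzero C)
    (ha : 0 < a) (hab : a ≤ b) (hbτ : b ≤ τ)
    (hd : d ∈ codeOfParityCheck (parityCheck a b τ α C)) {S : Finset ℕ} (hS : #S ≤ a)
    (hSt : ∀ i ∈ S, b - a ≤ i) (h : ∀ i, i ∉ S → zeroExtend d i = 0) (i : ℕ) :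
    zeroExtend d i = 0 := by
  have haτ : a ≤ τ := hab.trans hbτ
  rcases hab.eq_or_lt with hab' | hab'
  · exact eq_zero_of_card_of_eq hα hC ha hab' hbτ hd hS h i
  refine zeroExtend_eq_zero_of_le ha hab hbτ hd (fun j hj => ?_) i
  by_cases hmem : τ + (b - a) ∈ S
  · rcases Nat.eq_zero_or_pos j with rfl | hj0
    · exact h 0 fun h0 => by have := hSt 0 h0; omega
    refine hC.eq_zero_of_support haτ ha (zeroExtend d) (S.erase (τ + (b - a))) ?_ ?_
      (lower_row hab hbτ hd) j hj0 hj
    · have := card_erase_add_one hmem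
      omega
    · intro k _ hk hkS
      simp only [mem_erase, not_and] at hkS
      exact h k (hkS (by omega))
  · refine hC.eq_zero_of_support haτ (Nat.zero_le a) (zeroExtend d) S hS (fun j _ _ hj => h j hj)
      (fun r _ => ?_) j (Nat.zero_le j) hj
    have h1 := bottom_row hab hbτ hd r (Or.inr hab')
    rwa [h _ hmem, ite_self, add_zero] at h1

/-- The columns `[t : t+b-1]` of the matrix with block rows `[0 | P^a_{δ,τ-b}]` and `[I_a | C]` are
independent: the upper rows leave at most `a` nonzero entries, for which `C` suffices. Columns from
`τ` on are dropped together with as many upper rows. -/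
lemma AllMinorsNonzero.eq_zero_of_window {V : Type*} [AddCommGroup V] [Module F V]
    (hC : AllMinorsNonzero C) (hab : a ≤ b) (hbτ : b ≤ τ) {t : ℕ} (ht : b - a ≤ t) (htτ : t ≤ τ - a)
    (y : ℕ → V) (hy : ∀ j ≤ τ, ¬ (t ≤ j ∧ j + 1 ≤ t + b) → y j = 0) (hyτ : y τ = 0)
    (htop : ∀ i < b - a, t + b ≤ τ + i →
      ∑ j ∈ range (τ - b), pEntry a (b - a) (τ - b) i j • y (b + j) = 0)
    (hbot : ∀ r : Fin a, y r + ∑ j, C r j • y (a + j) = 0) :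
    ∀ j ≤ τ, y j = 0 := by
  obtain ⟨S, hS, hSy⟩ := exists_card_le_of_window a _ (b - a) (τ - b) (t - (b - a))
    (fun j => if b - a + j < τ then y (b - a + j) else 0) le_rfl (by omega)
    (fun j hj => by
      split_ifs at hj with hjτ
      · have : t ≤ b - a + j ∧ b - a + j + 1 ≤ t + b := by
          by_contra h'
          exact hj (hy _ hjτ.le h')
        omega
      · exact absurd rfl hj)
    (fun i hi hiv => by
      rw [← htop i hi (by omega)]
      refine sum_congr rfl fun j hj => ?_
      have := mem_range.1 hj
      rw [if_pos (by omega), show b - a + (a + j) = b + j by omega])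
  intro j hj
  refine hC.eq_zero_of_support (by omega) (Nat.zero_le a) y (S.image (b - a + ·))
    (card_image_le.trans hS) (fun j _ hj hjS => ?_) (fun r _ => hbot r) j (Nat.zero_le j) hj
  by_contra hne
  have hjτ : j ≠ τ := by
    rintro rfl
    exact hne hyτ
  have hjt : t ≤ j ∧ j + 1 ≤ t + b := by
    by_contra h'
    exact hne (hy j hj h')
  refine hjS (mem_image.2 ⟨j - (b - a), hSy _ ?_, by omega⟩)
  rwa [show b - a + (j - (b - a)) = j by omega, if_pos (by omega)]

/-- If the burst reaches the column `τ`, the coefficient `α ∉ F` there forces `c_τ = 0`; without this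
column the coefficients lie in `F` and the burst is recovered by `P` and `C`. -/
lemma eq_zero_of_burst (hα : α ∉ Set.range (algebraMap F K)) (hC : AllMinorsNonzero C)
    (ha : 0 < a) (hab : a ≤ b) (hbτ : b ≤ τ)
    (hd : d ∈ codeOfParityCheck (parityCheck a b τ α C)) {t : ℕ} (ht : b - a ≤ t)
    (htτ : t ≤ τ + 1 - a) (h : ∀ i, ¬ (t ≤ i ∧ i + 1 ≤ t + b) → zeroExtend d i = 0) (i : ℕ) :
    zeroExtend d i = 0 := by
  have haτ : a ≤ τ := hab.trans hbτ
  rcases hab.eq_or_lt with hab' | hab'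
  · refine eq_zero_of_card_of_eq hα hC ha hab' hbτ hd (S := Ico t (t + b)) (by simp [hab'])
      (fun j hj => h j fun hj' => hj ?_) i
    rw [mem_Ico]; omega
  have hlow := lower_row hab hbτ hd
  refine zeroExtend_eq_zero_of_le ha hab hbτ hd ?_ i
  have htop0 := top_row hbτ hd (i := 0) (by omega)
  rw [h 0 (by omega), if_pos rfl, add_zero, mul_zero, zero_add] at htop0
  -- by check `0`, a functional `φ` that kills `c_1, …, c_τ` also kills `α c_τ`
  have hφ0 : ∀ φ : K →ₗ[F] F, (∀ j, 1 ≤ j → j ≤ τ → φ (zeroExtend d j) = 0) →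
      φ (α * zeroExtend d τ) = 0 := by
    intro φ hφ
    have h1 := congrArg φ htop0
    rwa [map_add, map_sum, map_zero, sum_eq_zero, zero_add] at h1
    intro j hj
    have := mem_range.1 hj
    rw [map_nsmul, hφ _ (by omega) (by omega), smul_zero]
  by_cases htlast : t ≤ τ - a
  · have htop : ∀ i < b - a, t + b ≤ τ + i →
        ∑ j ∈ range (τ - b), pEntry a (b - a) (τ - b) i j • zeroExtend d (b + j) = 0 := by
      intro i hi hit
      have h1 := top_row hbτ hd hi
      rwa [h i (by omega), h (τ + i) (by omega), mul_zero, mul_zero, zero_add, add_zero] at h1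
    have hbot : ∀ r : Fin a, zeroExtend d r + ∑ j, C r j • zeroExtend d (a + j) = 0 := by
      intro r
      have h1 := bottom_row hab hbτ hd r (Or.inr hab')
      rwa [h (τ + (b - a)) (by omega), ite_self, add_zero] at h1
    refine hC.eq_zero_of_window hab hbτ ht htlast _ (fun j _ => h j) ?_ htop hbot
    by_contra hne
    obtain ⟨φ, hφ, hφα⟩ := exists_functional hα hne
    have h0 := hC.eq_zero_of_window hab hbτ ht htlast (fun j => φ (zeroExtend d j))
      (fun j _ hj => by rw [h j hj, map_zero]) hφ (fun i hi hit => by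
        simpa only [map_sum, map_nsmul, map_zero] using congrArg φ (htop i hi hit))
      (fun r => row_map φ (hbot r))
    exact hφα (hφ0 φ fun j _ hj => h0 j hj)
  · have hzero : ∀ j ≤ τ, j ∉ Ico (τ + 1 - a) τ → j ≠ τ → zeroExtend d j = 0 := by
      intro j hj hjS hjτ
      refine h j fun hj' => hjS ?_
      rw [mem_Ico]; omega
    have hcard : #(Ico (τ + 1 - a) τ) ≤ a - 1 := by
      rw [Nat.card_Ico]; omega
    have hlast : zeroExtend d τ = 0 := by
      by_contra hne
      obtain ⟨φ, hφ, hφα⟩ := exists_functional hα hne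
      refine hφα (hφ0 φ ?_)
      refine hC.eq_zero_of_support haτ ha (fun j => φ (zeroExtend d j)) _ hcard
        (fun j _ hj hjS => ?_) (fun r hr => row_map φ (hlow r hr))
      by_cases hjt : j = τ
      · rw [hjt, hφ]
      · rw [hzero j hj hjS hjt, map_zero]
    intro j hj
    rcases Nat.eq_zero_or_pos j with rfl | hj0
    · exact h 0 (by omega)
    refine hC.eq_zero_of_support haτ ha (zeroExtend d) _ hcard (fun j _ hj hjS => ?_) hlow j hj0 hj
    by_cases hjt : j = τ
    · rw [hjt, hlast]
    · exact hzero j hj hjS hjt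

end Recovery

section Properties

lemma recoverable_iff {K : Type*} [Field K] {n : ℕ} {𝒞 : Submodule K (Fin n → K)} {A : Set (Fin n)}
    {t : Fin n} : Recoverable 𝒞 A t ↔ ∀ d ∈ 𝒞, (∀ i ∈ A, d i = 0) → d t = 0 := by
  constructor
  · intro h d hd hA
    exact h d hd 0 𝒞.zero_mem hA
  · intro h c hc c' hc' hA
    exact sub_eq_zero.1 (h (c - c') (𝒞.sub_mem hc hc') fun i hi => sub_eq_zero.2 (hA i hi))

variable {F K : Type*} [Field F] [Field K] [Algebra F K] {a b τ : ℕ} {α : K}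
  {C : Matrix (Fin a) (Fin (τ + 1 - a)) F}

lemma propB1_parityCheck (hα : α ∉ Set.range (algebraMap F K)) (hbτ : b ≤ τ) :
    PropB1 a b τ (codeOfParityCheck (parityCheck a b τ α C)) := by
  intro t ht
  rw [recoverable_iff]
  intro d hd h
  rw [← zeroExtend_coe d]
  refine eq_zero_of_burst_of_lt hα hbτ hd ht fun i hi hit => ?_
  rw [zeroExtend_of_lt d (by omega)]
  exact h _ ⟨hi, hit⟩

lemma zeroExtend_eq_zero_of_notMem_map {K : Type*} [Zero K] {n : ℕ} {d : Fin n → K}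
    {A : Finset (Fin n)} {i : ℕ} (hi : i ∉ A.map Fin.valEmbedding)
    (h : ∀ hi : i < n, (⟨i, hi⟩ : Fin n) ∉ A → d ⟨i, hi⟩ = 0) : zeroExtend d i = 0 := by
  by_cases hin : i < n
  · rw [zeroExtend_of_lt d hin]
    exact h hin fun hA => hi (mem_map.2 ⟨_, hA, rfl⟩)
  · exact dif_neg hin

lemma propR1_parityCheck (hα : α ∉ Set.range (algebraMap F K)) (hC : AllMinorsNonzero C)
    (ha : 0 < a) (hab : a ≤ b) (hbτ : b ≤ τ) :
    PropR1 a b τ (codeOfParityCheck (parityCheck a b τ α C)) := by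
  intro t ht A hA hAt
  rw [recoverable_iff]
  intro d hd h
  rw [← zeroExtend_coe d]
  refine eq_zero_of_card_of_lt hα hC ha hab hbτ hd ht (S := A.map Fin.valEmbedding)
    (by rw [card_map, hA]) (fun i hi => ?_) (fun i hi hit hiA => ?_)
  · obtain ⟨j, hj, rfl⟩ := mem_map.1 hi
    exact (hAt j hj).1
  · exact zeroExtend_eq_zero_of_notMem_map hiA fun hin hiA' =>
      h _ ⟨hi, fun h' => hit (congrArg Fin.val h'), hiA'⟩

lemma propB2_parityCheck (hα : α ∉ Set.range (algebraMap F K)) (hC : AllMinorsNonzero C)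
    (ha : 0 < a) (hab : a ≤ b) (hbτ : b ≤ τ) :
    PropB2 a b τ (codeOfParityCheck (parityCheck a b τ α C)) := by
  intro t ht htτ j _ _
  rw [recoverable_iff]
  intro d hd h
  rw [← zeroExtend_coe d]
  refine eq_zero_of_burst hα hC ha hab hbτ hd ht htτ (fun i hi => ?_) j
  by_cases hin : i < τ + 1 + (b - a)
  · rw [zeroExtend_of_lt d hin]
    exact h _ hi
  · exact dif_neg hin

lemma propR2_parityCheck (hα : α ∉ Set.range (algebraMap F K)) (hC : AllMinorsNonzero C)
    (ha : 0 < a) (hab : a ≤ b) (hbτ : b ≤ τ) :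
    PropR2 a b τ (codeOfParityCheck (parityCheck a b τ α C)) := by
  intro A hA hAt j _
  rw [recoverable_iff]
  intro d hd h
  rw [← zeroExtend_coe d]
  refine eq_zero_of_card hα hC ha hab hbτ hd (S := A.map Fin.valEmbedding)
    (by rw [card_map, hA]) (fun i hi => ?_) (fun i hiA => ?_) j
  · obtain ⟨j, hj, rfl⟩ := mem_map.1 hi
    exact hAt j hj
  · exact zeroExtend_eq_zero_of_notMem_map hiA fun hin hiA' => h _ hiA'

end Properties

/-! ### Diagonal embedding -/

section DiagonalEmbedding

variable {K : Type*} [Field K] {k n : ℕ}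

/-- A code of dimension at least `k` whose words are determined by their first `k` symbols has a
systematic encoder. -/
lemma exists_systematic_encoder (hkn : k ≤ n) (𝒞 : Submodule K (Fin n → K))
    (hinj : ∀ d ∈ 𝒞, (∀ i : Fin k, d (Fin.castLE hkn i) = 0) → d = 0)
    (hdim : k ≤ Module.finrank K 𝒞) :
    Module.finrank K 𝒞 = k ∧
      ∃ φ : (Fin k → K) → Fin n → K, ∀ m, φ m ∈ 𝒞 ∧ ∀ i, φ m (Fin.castLE hkn i) = m i := by
  set π : 𝒞 →ₗ[K] (Fin k → K) := (LinearMap.funLeft K K (Fin.castLE hkn)).comp 𝒞.subtype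
  have hπ : Function.Injective π := by
    rw [← LinearMap.ker_eq_bot, LinearMap.ker_eq_bot']
    rintro ⟨d, hd⟩ h
    exact Subtype.ext (hinj d hd fun i => congrFun h i)
  have hfin : Module.finrank K 𝒞 = Module.finrank K (Fin k → K) := by
    refine le_antisymm (LinearMap.finrank_le_finrank_of_injective hπ) ?_
    simpa using hdim
  have hsurj : Function.Surjective π :=
    (LinearMap.injective_iff_surjective_of_finrank_eq_finrank hfin).1 hπ
  refine ⟨by simpa using hfin, ?_⟩
  choose ψ hψ using hsurj
  exact ⟨fun m => ψ m, fun m => ⟨(ψ m).2, fun i => congrFun (hψ m) i⟩⟩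

/-- Each diagonal of coded symbols is the systematic codeword of the message symbols on it. -/
lemma existsUnique_isDiagonalEmbedding (hkn : k ≤ n) (𝒞 : Submodule K (Fin n → K))
    (hinj : ∀ d ∈ 𝒞, (∀ i : Fin k, d (Fin.castLE hkn i) = 0) → d = 0)
    (hdim : k ≤ Module.finrank K 𝒞) :
    ∃! X : PacketCode K k n, X.IsDiagonalEmbedding 𝒞 := by
  obtain ⟨-, φ, hφ⟩ := exists_systematic_encoder hkn 𝒞 hinj hdim
  have huniq : ∀ c ∈ 𝒞, c = φ fun i => c (Fin.castLE hkn i) := by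
    intro c hc
    refine sub_eq_zero.1 (hinj _ (𝒞.sub_mem hc (hφ _).1) fun i => ?_)
    rw [Pi.sub_apply, (hφ _).2, sub_self]
  refine ⟨⟨hkn, fun u t j => φ (fun i => u (t - j + i) i) j, fun u t i => ?_,
    fun u v t huv => ?_⟩, fun u t => ?_, fun X hX => ?_⟩
  · rw [(hφ _).2]
    simp
  · funext j
    by_cases hj : j.val < k
    · have hj' : j = Fin.castLE hkn ⟨j, hj⟩ := rfl
      rw [hj', (hφ _).2, (hφ _).2]
      simp [huv t le_rfl]
    · have : (fun i : Fin k => u (t - j + i) i) = fun i : Fin k => v (t - j + i) i := by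
        funext i
        rw [huv _ (by omega)]
      rw [this]
  · simpa using (hφ fun i => u (t + i) i).1
  · ext u t j
    have h := congrFun (huniq _ (hX u (t - j))) j
    simp only [sub_add_cancel] at h
    rw [h]
    simp only
    congr 1
    funext i
    exact X.systematic u _ i

end DiagonalEmbedding

section Streaming

lemma card_le_ncard_of_add_mem {n : ℕ} (A : Finset (Fin n)) (s : ℤ) {T : Set ℤ} (hT : T.Finite)
    (h : ∀ x ∈ A, s + (x.val : ℤ) ∈ T) : #A ≤ T.ncard := by
  rw [Set.ncard_eq_toFinset_card T hT]
  refine card_le_card_of_injOn (fun x => s + (x.val : ℤ)) (fun x hx => by simpa using h x hx) ?_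
  intro x _ y _ hxy
  ext
  simpa using hxy

lemma card_filter_fin_Icc {n l m : ℕ} (hm : m < n) :
    #{x : Fin n | l ≤ x.val ∧ x.val ≤ m} = m + 1 - l := by
  rw [← card_map Fin.valEmbedding, ← Nat.card_Icc]
  congr 1
  ext j
  simp only [mem_map, mem_filter, mem_univ, true_and, Fin.valEmbedding_apply, mem_Icc]
  exact ⟨by rintro ⟨i, hi, rfl⟩; exact hi, fun hj => ⟨⟨j, by omega⟩, hj, rfl⟩⟩

variable {K : Type*} [Field K] {a b τ k : ℕ}

/-- Every diagonal is decoded by itself: its first `b - a` symbols one after the other, and the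
others, which lie in a single window of `τ + 1` time units, at once. -/
lemma PacketCode.IsDiagonalEmbedding.isStreaming (ha : 0 < a) (hab : a ≤ b) (hbτ : b ≤ τ)
    {𝒞 : Submodule K (Fin (τ + 1 + (b - a)) → K)}
    (hB1 : PropB1 a b τ 𝒞) (hR1 : PropR1 a b τ 𝒞) (hB2 : PropB2 a b τ 𝒞) (hR2 : PropR2 a b τ 𝒞)
    {X : PacketCode K k (τ + 1 + (b - a))} (hX : X.IsDiagonalEmbedding 𝒞) :
    X.IsStreaming a b τ := by
  classical
  intro E hE t u v huv
  funext i₀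
  rw [← X.systematic u, ← X.systematic v]
  set i := Fin.castLE X.k_le i₀
  obtain ⟨s, rfl⟩ : ∃ s : ℤ, t = s + (i.val : ℤ) := ⟨t - i.val, by omega⟩
  set c : Fin (τ + 1 + (b - a)) → K := fun j => X.enc u (s + (j.val : ℤ)) j with hc
  set c' : Fin (τ + 1 + (b - a)) → K := fun j => X.enc v (s + (j.val : ℤ)) j with hc'
  have hcmem : c ∈ 𝒞 := hX u s
  have hcmem' : c' ∈ 𝒞 := hX v s
  have hknown : ∀ j : Fin (τ + 1 + (b - a)), j.val ≤ τ + i.val → s + (j.val : ℤ) ∉ E →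
      c j = c' j := fun j hj hjE => congrFun (huv _ (by omega) hjE) j
  -- the symbols with index below `b - a`, in increasing order
  have hfirst : ∀ m : ℕ, ∀ j : Fin (τ + 1 + (b - a)), j.val = m → m < b - a → m ≤ i.val →
      c j = c' j := by
    intro m
    induction m using Nat.strong_induction_on with
    | _ m ih =>
    rintro j rfl hjδ hji
    by_cases hjE : s + (j.val : ℤ) ∈ E
    swap
    · exact hknown j (by omega) hjE
    have hjmem : s + (j.val : ℤ) ∈ E ∩ Set.Icc (s + (j.val : ℤ)) (s + j.val + τ) :=
      ⟨hjE, by simp⟩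
    rcases hE (s + j.val) with ⟨s', l, hl, hburst⟩ | hcard
    · refine hB1 j hjδ c hcmem c' hcmem' fun x hx => ?_
      obtain ⟨hxτ, hx⟩ := hx
      by_cases hxj : x.val < j.val
      · exact ih x hxj x rfl (by omega) (by omega)
      · refine hknown x (by omega) fun hxE => ?_
        have hxmem : s + (x.val : ℤ) ∈ E ∩ Set.Icc (s + (j.val : ℤ)) (s + j.val + τ) :=
          ⟨hxE, by simp only [Set.mem_Icc]; omega⟩
        rw [hburst] at hxmem hjmem
        simp only [Set.mem_Ico] at hxmem hjmem
        omega
    · set A₀ : Finset (Fin (τ + 1 + (b - a))) :=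
        {x | (j.val + 1 ≤ x.val ∧ x.val ≤ τ + j.val) ∧ s + (x.val : ℤ) ∈ E} with hA₀
      have hjA₀ : j ∉ A₀ := by simp [hA₀]
      have h1 : #A₀ + 1 ≤ a := by
        rw [← card_insert_of_notMem hjA₀]
        refine (card_le_ncard_of_add_mem _ s ((Set.finite_Icc _ _).inter_of_right E) ?_).trans hcard
        intro x hx
        rcases mem_insert.1 hx with rfl | hx
        · exact hjmem
        · simp only [hA₀, mem_filter, mem_univ, true_and] at hx
          exact ⟨hx.2, by simp only [Set.mem_Icc]; omega⟩
      obtain ⟨A, hA₀A, hA, hAcard⟩ := exists_subsuperset_card_eq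
        (s := A₀) (t := {x | j.val + 1 ≤ x.val ∧ x.val ≤ τ + j.val}) (n := a - 1)
        (fun x hx => by
          simp only [hA₀, mem_filter, mem_univ, true_and] at hx ⊢
          exact hx.1)
        (by omega) (by rw [card_filter_fin_Icc (by omega)]; omega)
      refine hR1 j hjδ A hAcard (fun x hx => by simpa using hA hx) c hcmem c' hcmem' fun x hx => ?_
      obtain ⟨hxτ, hxj, hxA⟩ := hx
      have hxj' : x.val ≠ j.val := fun h => hxj (Fin.ext h)
      by_cases hlt : x.val < j.val
      · exact ih x hlt x rfl (by omega) (by omega)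
      · refine hknown x (by omega) fun hxE => hxA (hA₀A ?_)
        simp only [hA₀, mem_filter, mem_univ, true_and]
        exact ⟨by omega, hxE⟩
  change c i = c' i
  by_cases hiδ : i.val < b - a
  · exact hfirst _ i rfl hiδ le_rfl
  by_cases hiE : s + (i.val : ℤ) ∈ E
  swap
  · exact hknown i (by omega) hiE
  have himem : s + (i.val : ℤ) ∈ E ∩ Set.Icc (s + ((b - a : ℕ) : ℤ)) (s + (b - a : ℕ) + τ) :=
    ⟨hiE, by simp only [Set.mem_Icc]; omega⟩
  rcases hE (s + (b - a : ℕ)) with ⟨s', l, hl, hburst⟩ | hcard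
  · have hs' : s' ∈ E ∩ Set.Icc (s + ((b - a : ℕ) : ℤ)) (s + (b - a : ℕ) + τ) := by
      rw [hburst] at himem ⊢
      simp only [Set.mem_Ico] at himem ⊢
      omega
    have hs'' := hs'.2
    rw [hburst] at himem
    simp only [Set.mem_Ico, Set.mem_Icc] at himem hs''
    -- the window of length `b` that starts with the burst, moved to the left if it is too long
    refine hB2 (min (s' - s).toNat (τ + 1 - a)) (by omega) (by omega) i (by omega) (by omega)
      c hcmem c' hcmem' fun x hx => ?_
    simp only [Set.mem_ofPred_eq] at hx
    by_cases hxδ : x.val < b - a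
    · exact hfirst _ x rfl hxδ (by omega)
    · refine hknown x (by omega) fun hxE => ?_
      have hxmem : s + (x.val : ℤ) ∈ E ∩ Set.Icc (s + ((b - a : ℕ) : ℤ)) (s + (b - a : ℕ) + τ) :=
        ⟨hxE, by simp only [Set.mem_Icc]; omega⟩
      rw [hburst] at hxmem
      simp only [Set.mem_Ico] at hxmem
      omega
  · set A₀ : Finset (Fin (τ + 1 + (b - a))) :=
      {x | (b - a ≤ x.val ∧ x.val ≤ τ + (b - a)) ∧ s + (x.val : ℤ) ∈ E} with hA₀
    have h1 : #A₀ ≤ a := by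
      refine (card_le_ncard_of_add_mem _ s ((Set.finite_Icc _ _).inter_of_right E) ?_).trans hcard
      intro x hx
      simp only [hA₀, mem_filter, mem_univ, true_and] at hx
      exact ⟨hx.2, by simp only [Set.mem_Icc]; omega⟩
    obtain ⟨A, hA₀A, hA, hAcard⟩ := exists_subsuperset_card_eq
      (s := A₀) (t := {x | b - a ≤ x.val ∧ x.val ≤ τ + (b - a)}) (n := a)
      (fun x hx => by
        simp only [hA₀, mem_filter, mem_univ, true_and] at hx ⊢
        exact hx.1)
      h1 (by rw [card_filter_fin_Icc (by omega)]; omega)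
    have hmem : ∀ x : Fin (τ + 1 + (b - a)), b - a ≤ x.val → s + (x.val : ℤ) ∈ E → x ∈ A := by
      intro x hxδ hxE
      refine hA₀A ?_
      simp only [hA₀, mem_filter, mem_univ, true_and]
      exact ⟨by omega, hxE⟩
    refine hR2 A hAcard (fun x hx => by
      have := hA hx
      simp only [mem_filter, mem_univ, true_and] at this
      exact this.1) i (hmem i (by omega) hiE) c hcmem c' hcmem' fun x hx => ?_
    by_cases hxδ : x.val < b - a
    · exact hfirst _ x rfl hxδ (by omega)
    · exact hknown x (by omega) fun hxE => hx (hmem x (by omega) hxE)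

end Streaming

/-! ### The bound on the rate -/

section RateBound

/-- The periodic erasures of bursts of length `b`, with `τ + 1 - a` non-erased time units between
them. -/
def periodicErasures (a b τ : ℕ) : Set ℤ :=
  {x | x % ((τ + 1 - a + b : ℕ) : ℤ) < b}

/-- A window that meets two bursts contains the gap between them, hence exactly `a` erasures. -/
lemma permissibleErasures_periodicErasures {a b τ : ℕ} (hab : a ≤ b) (hbτ : b ≤ τ) :
    PermissibleErasures a b τ (periodicErasures a b τ) := by
  intro t
  obtain ⟨p, hp⟩ : ∃ p : ℕ, p = τ + 1 - a + b := ⟨_, rfl⟩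
  have hp0 : (0 : ℤ) < p := by omega
  have hr0 := Int.emod_nonneg t hp0.ne'
  have hrp := Int.emod_lt_of_pos t hp0
  have hdiv := Int.emod_add_mul_ediv t p
  obtain ⟨r, hr⟩ : ∃ r, t % (p : ℤ) = r := ⟨_, rfl⟩
  obtain ⟨w, hw⟩ : ∃ w, (p : ℤ) * (t / p) = w := ⟨_, rfl⟩
  rw [hr] at hr0 hrp hdiv
  rw [hw] at hdiv
  have hmod : ∀ x : ℤ, w ≤ x → x < w + 2 * p →
      x % (p : ℤ) = if x < w + p then x - w else x - w - p := by
    intro x hx hx'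
    split_ifs with h
    · rw [← Int.emod_eq_of_lt (a := x - w) (b := p) (by omega) (by omega), ← hw,
        Int.sub_mul_emod_self_left]
    · rw [← Int.emod_eq_of_lt (a := x - w - p) (b := p) (by omega) (by omega),
        Int.sub_emod_right, ← hw, Int.sub_mul_emod_self_left]
  have hmem : ∀ x : ℤ, x ∈ periodicErasures a b τ ∩ Set.Icc t (t + τ) ↔
      (t ≤ x ∧ x ≤ t + τ) ∧ (x < w + b ∨ w + p ≤ x ∧ x < w + p + b) := by
    intro x
    simp only [periodicErasures, Set.mem_inter_iff, Set.mem_ofPred_eq, Set.mem_Icc, ← hp]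
    constructor
    · rintro ⟨h1, h2⟩
      rw [hmod x (by omega) (by omega)] at h1
      split_ifs at h1 <;> omega
    · rintro ⟨h1, h2⟩
      rw [hmod x (by omega) (by omega)]
      split_ifs <;> omega
  by_cases hrb : r < b
  · by_cases h2 : w + p ≤ t + τ
    · right
      have hsub : periodicErasures a b τ ∩ Set.Icc t (t + τ) ⊆
          ((Ico t (w + b) ∪ Icc (w + p) (t + τ) : Finset ℤ) : Set ℤ) := by
        intro x hx
        rw [hmem] at hx
        simp only [coe_union, coe_Ico, coe_Icc, Set.mem_union, Set.mem_Ico, Set.mem_Icc]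
        omega
      refine (Set.ncard_le_ncard hsub (finite_toSet _)).trans ?_
      rw [Set.ncard_coe_finset]
      refine (card_union_le _ _).trans ?_
      rw [Int.card_Ico, Int.card_Icc]
      omega
    · left
      refine ⟨t, (w + b - t).toNat, by omega, ?_⟩
      ext x
      rw [hmem, Set.mem_Ico]
      omega
  · left
    refine ⟨w + p, min b (t + τ + 1 - (w + p)).toNat, by omega, ?_⟩
    ext x
    rw [hmem, Set.mem_Ico]
    omega

/-- Among the first `N` periods and `τ` more time units, at most `N (τ + 1 - a) + τ` are not
erased. -/
lemma card_filter_notMem_periodicErasures_le (a b τ N : ℕ)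
    [DecidablePred (· ∉ periodicErasures a b τ)] :
    #{x ∈ Ico (0 : ℤ) ((N * (τ + 1 - a + b) + τ : ℕ) : ℤ) | x ∉ periodicErasures a b τ} ≤
      N * (τ + 1 - a) + τ := by
  obtain ⟨p, hp⟩ : ∃ p : ℕ, p = τ + 1 - a + b := ⟨_, rfl⟩
  rw [← hp]
  have hsub : {x ∈ Ico (0 : ℤ) ((N * p + τ : ℕ) : ℤ) | x ∉ periodicErasures a b τ} ⊆
      ((range N ×ˢ Ico b p).image fun y => ((p * y.1 + y.2 : ℕ) : ℤ)) ∪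
        Ico ((N * p : ℕ) : ℤ) ((N * p + τ : ℕ) : ℤ) := by
    intro x hx
    simp only [periodicErasures, mem_filter, mem_Ico, Set.mem_ofPred_eq, ← hp] at hx
    rw [mem_union, mem_Ico]
    by_cases hxN : ((N * p : ℕ) : ℤ) ≤ x
    · exact Or.inr ⟨hxN, hx.1.2⟩
    · left
      lift x to ℕ using hx.1.1
      rw [← Int.natCast_mod] at hx
      have hx2 : b ≤ x % p := by omega
      have hxN' : x < N * p := by omega
      have hp0 : 0 < p := by
        rcases Nat.eq_zero_or_pos p with rfl | h
        · simp at hxN'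
        · exact h
      refine mem_image.2 ⟨(x / p, x % p), ?_, by simp only [Nat.div_add_mod]⟩
      rw [mem_product, mem_range, mem_Ico]
      exact ⟨Nat.div_lt_of_lt_mul (by rwa [mul_comm]), hx2, Nat.mod_lt _ hp0⟩
  refine (card_le_card hsub).trans ((card_union_le _ _).trans ?_)
  refine Nat.add_le_add (card_image_le.trans ?_) ?_
  · rw [card_product, card_range, Nat.card_Ico, hp, Nat.add_sub_cancel]
  · rw [Int.card_Ico]
    omega

/-- Messages in the first `N` periods are determined by the non-erased packets up to `τ` time units
later, since causality fixes all packets with negative index. -/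
lemma PacketCode.IsStreaming.mul_le {L : Type*} [Field L] [Finite L] {a b τ k n : ℕ}
    {Y : PacketCode L k n} (hY : Y.IsStreaming a b τ) (hab : a ≤ b) (hbτ : b ≤ τ) (N : ℕ) :
    k * (N * (τ + 1 - a + b)) ≤ n * (N * (τ + 1 - a) + τ) := by
  classical
  have := Fintype.ofFinite L
  set T : ℕ := N * (τ + 1 - a + b) with hT
  set J : Finset ℤ := {x ∈ Ico (0 : ℤ) ((T + τ : ℕ) : ℤ) | x ∉ periodicErasures a b τ} with hJ
  set stream : (Fin T → Fin k → L) → ℤ → Fin k → L :=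
    fun m t => if h : 0 ≤ t ∧ t < T then m ⟨t.toNat, by omega⟩ else 0 with hstream
  have hinj : Function.Injective fun (m : Fin T → Fin k → L) (x : J) => Y.enc (stream m) x.1 := by
    intro m m' h
    funext t
    have ht := hY _ (permissibleErasures_periodicErasures hab hbτ) (t.val : ℤ)
      (stream m) (stream m') (fun s hs hsE => by
        by_cases hs0 : 0 ≤ s
        · have hsJ : s ∈ J := by
            rw [hJ, mem_filter, mem_Ico]
            exact ⟨by omega, hsE⟩
          exact congrFun h ⟨s, hsJ⟩
        · refine Y.causal _ _ _ fun s' hs' => ?_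
          simp only [hstream]
          rw [dif_neg (by omega), dif_neg (by omega)])
    simp only [hstream] at ht
    rw [dif_pos (by omega), dif_pos (by omega)] at ht
    simpa using ht
  have hcard := Fintype.card_le_of_injective _ hinj
  simp only [Fintype.card_fun, Fintype.card_fin, Fintype.card_coe, ← pow_mul] at hcard
  have h1 := (Nat.pow_le_pow_iff_right Fintype.one_lt_card).1 hcard
  exact h1.trans (Nat.mul_le_mul_left _ (card_filter_notMem_periodicErasures_le a b τ N))

lemma PacketCode.IsStreaming.rate_le {L : Type*} [Field L] [Finite L] {a b τ k n : ℕ}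
    {Y : PacketCode L k n} (hY : Y.IsStreaming a b τ) (hab : a ≤ b) (hbτ : b ≤ τ) :
    Y.rate ≤ ((τ + 1 - a : ℕ) : ℚ) / ((τ + 1 - a + b : ℕ) : ℚ) := by
  have hle : k * (τ + 1 - a + b) ≤ (τ + 1 - a) * n := by
    -- the additive term `n τ` is negligible over many periods
    have h := hY.mul_le hab hbτ (n * τ + 1)
    by_contra hlt
    push Not at hlt
    have h2 := Nat.mul_le_mul_left (n * τ + 1) (Nat.succ_le_of_lt hlt)
    simp only [Nat.succ_eq_add_one] at h2
    nlinarith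
  rcases Nat.eq_zero_or_pos n with rfl | hn
  · simp only [PacketCode.rate, Nat.cast_zero, div_zero]
    positivity
  · rw [PacketCode.rate, div_le_div_iff₀ (by exact_mod_cast hn) (by exact_mod_cast (by omega))]
    exact_mod_cast hle

end RateBound

/-! ### Existence of the matrix `C` -/

section Cauchy

open Polynomial

/-- A Cauchy matrix `1 / (x_i - y_j)`, extended by a row of ones (a point `x_i` at infinity), has no
vanishing minor. A linear relation among the `m` rows of a minor becomes, after clearing of
denominators, a polynomial of degree less than `m` with `m` roots; evaluation at the points `x_i`
shows that the relation is trivial. -/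
lemma det_extended_cauchy_ne_zero {F ι : Type*} [Field F] [Fintype ι] [DecidableEq ι]
    (x : ι → Option F) (y : ι → F) (hx : Function.Injective x) (hy : Function.Injective y)
    (hxy : ∀ i j, x i ≠ some (y j)) :
    (Matrix.of fun i j => (x i).elim 1 fun z => (z - y j)⁻¹).det ≠ 0 := by
  intro hdet
  obtain ⟨l, hl0, hl⟩ := Matrix.exists_vecMul_eq_zero_iff.2 hdet
  set w : ι → F[X] := fun i => (x i).elim 1 fun z => C z - X with hw
  have hwy : ∀ i j, (w i).eval (y j) ≠ 0 := by
    intro i j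
    simp only [hw]
    rcases hxi : x i with _ | z
    · simp
    · simp only [Option.elim_some, eval_sub, eval_C, eval_X, ne_eq, sub_eq_zero]
      rintro rfl
      exact hxy i j hxi
  have hwx : ∀ i i' z, x i = some z → i' ≠ i → (w i').eval z ≠ 0 := by
    intro i i' z hi hne
    simp only [hw]
    rcases hxi : x i' with _ | z'
    · simp
    · simp only [Option.elim_some, eval_sub, eval_C, eval_X, ne_eq, sub_eq_zero]
      rintro rfl
      exact hne (hx (hxi.trans hi.symm))
  have hw0 : ∀ i, w i ≠ 0 := by
    intro i h
    have := hwy i i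
    rw [h, eval_zero] at this
    exact this rfl
  have hwdeg : ∀ i, (w i).natDegree ≤ 1 := by
    intro i
    simp only [hw]
    rcases x i with _ | z
    · simp
    · exact (natDegree_sub_le _ _).trans (by simp)
  set Q : F[X] := ∑ i, C (l i) * ∏ i' ∈ univ.erase i, w i' with hQ
  obtain ⟨i₀, hi₀⟩ : ∃ i, l i ≠ 0 := by
    by_contra! h
    exact hl0 (funext h)
  have hcard : 0 < Fintype.card ι := Fintype.card_pos_iff.2 ⟨i₀⟩
  have hQdeg : Q.natDegree < Fintype.card ι := by
    refine lt_of_le_of_lt (natDegree_sum_le_of_forall_le (n := Fintype.card ι - 1) _ _ fun i _ => ?_)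
      (by omega)
    refine (natDegree_C_mul_le _ _).trans ((natDegree_prod_le _ _).trans ?_)
    refine (sum_le_card_nsmul _ _ 1 fun i' _ => hwdeg i').trans ?_
    simp [card_erase_of_mem]
  have hQ0 : Q = 0 := by
    refine eq_zero_of_natDegree_lt_card_of_eval_eq_zero Q hy (fun j => ?_) hQdeg
    have hj : ∑ i, l i * ((w i).eval (y j))⁻¹ = 0 := by
      refine Eq.trans ?_ (congrFun hl j)
      simp only [Matrix.vecMul, dotProduct, Matrix.of_apply, hw]
      refine sum_congr rfl fun i _ => ?_
      rcases x i with _ | z <;> simp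
    have hj' := congrArg (· * ∏ i, (w i).eval (y j)) hj
    simp only [sum_mul, zero_mul] at hj'
    rw [hQ, eval_finsetSum, ← hj']
    refine sum_congr rfl fun i _ => ?_
    rw [eval_mul, eval_C, eval_prod, ← mul_prod_erase univ _ (mem_univ i), mul_assoc,
      inv_mul_cancel_left₀ (hwy i j)]
  have hfin : ∀ i z, x i = some z → l i = 0 := by
    intro i z hi
    have h := congrArg (eval z) hQ0
    rw [hQ, eval_finsetSum, sum_eq_single_of_mem i (mem_univ i), eval_mul, eval_C, eval_prod,
      eval_zero] at h
    · refine (mul_eq_zero.1 h).resolve_right (prod_ne_zero_iff.2 fun i' hi' => ?_)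
      exact hwx i i' z hi (ne_of_mem_erase hi')
    · intro i' _ hne
      rw [eval_mul, eval_prod, prod_eq_zero (mem_erase.2 ⟨hne.symm, mem_univ i⟩), mul_zero]
      simp [hw, hi]
  have hinf : x i₀ = none := by
    rcases hxi : x i₀ with _ | z
    · rfl
    · exact absurd (hfin i₀ z hxi) hi₀
  rw [hQ, sum_eq_single_of_mem i₀ (mem_univ _)] at hQ0
  · rcases mul_eq_zero.1 hQ0 with h | h
    · exact hi₀ (C_eq_zero.1 h)
    · exact prod_ne_zero_iff.2 (fun i' _ => hw0 i') h
  · intro i _ hne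
    have : l i = 0 := by
      rcases hxi : x i with _ | z
      · exact absurd (hx (hxi.trans hinf.symm)) hne
      · exact hfin i z hxi
    rw [this, C_0, zero_mul]

/-- One point at infinity and `r + s - 1` points of `F` suffice for an `r × s` matrix. -/
lemma exists_allMinorsNonzero {F : Type*} [Field F] [Finite F] {r s : ℕ} (hr : 0 < r)
    (h : r - 1 + s ≤ Nat.card F) : ∃ C : Matrix (Fin r) (Fin s) F, AllMinorsNonzero C := by
  have := Fintype.ofFinite F
  obtain ⟨p⟩ : Nonempty (Fin (r - 1 + s) ↪ F) := by
    apply Function.Embedding.nonempty_of_card_le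
    rwa [Fintype.card_fin, ← Nat.card_eq_fintype_card]
  let x : Fin r → Option F := fun i =>
    if hi : i.val = 0 then none else some (p ⟨i.val - 1, by omega⟩)
  let y : Fin s → F := fun j => p ⟨r - 1 + j.val, by omega⟩
  have hx : Function.Injective x := by
    intro i i' hii
    simp only [x] at hii
    split_ifs at hii with h1 h2 h2
    · ext; omega
    · have := congrArg Fin.val (p.injective (Option.some.inj hii))
      simp only at this
      ext; omega
  have hy : Function.Injective y := by
    intro j j' hjj
    have := congrArg Fin.val (p.injective hjj)
    simp only at this
    ext; omega
  refine ⟨Matrix.of fun i j => (x i).elim 1 fun z => (z - y j)⁻¹, fun m f g hf hg => ?_⟩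
  refine det_extended_cauchy_ne_zero (x ∘ f) (y ∘ g) (hx.comp hf) (hy.comp hg) fun i j hij => ?_
  simp only [x, y, Function.comp_apply] at hij
  split_ifs at hij with h0
  have := congrArg Fin.val (p.injective (Option.some.inj hij))
  simp only at this
  omega

end Cauchy

/-! ### Rate-optimal streaming codes -/

lemma le_finrank_codeOfParityCheck {K : Type*} [Field K] {r n : ℕ} (H : Matrix (Fin r) (Fin n) K) :
    n - r ≤ Module.finrank K (codeOfParityCheck H) := by
  have h := LinearMap.finrank_range_add_finrank_ker H.mulVecLin
  have h' := Submodule.finrank_le (LinearMap.range H.mulVecLin)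
  rw [Module.finrank_fin_fun] at h h'
  unfold codeOfParityCheck
  omega

theorem mainTheorem1 (a b τ q : ℕ) (ha : 0 < a) (hab : a ≤ b) (hbτ : b ≤ τ)
    (hq : IsPrimePow q) (hqτ : τ ≤ q)
    {F K : Type*} [Field F] [Finite F] [Field K] [Finite K] [Algebra F K]
    (hF : Nat.card F = q) (hK : Nat.card K = q ^ 2) :
    (∃ C : Matrix (Fin a) (Fin (τ + 1 - a)) F, AllMinorsNonzero C) ∧
    ∀ (α : K) (C : Matrix (Fin a) (Fin (τ + 1 - a)) F),
      α ∉ Set.range (algebraMap F K) → AllMinorsNonzero C →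
        Module.finrank K (codeOfParityCheck (parityCheck a b τ α C)) = τ + 1 - a ∧
        PropB1 a b τ (codeOfParityCheck (parityCheck a b τ α C)) ∧
        PropR1 a b τ (codeOfParityCheck (parityCheck a b τ α C)) ∧
        PropB2 a b τ (codeOfParityCheck (parityCheck a b τ α C)) ∧
        PropR2 a b τ (codeOfParityCheck (parityCheck a b τ α C)) ∧
        (∃! X : PacketCode K (τ + 1 - a) (τ + 1 + (b - a)),
          X.IsDiagonalEmbedding (codeOfParityCheck (parityCheck a b τ α C))) ∧
        ∀ X : PacketCode K (τ + 1 - a) (τ + 1 + (b - a)),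
          X.IsDiagonalEmbedding (codeOfParityCheck (parityCheck a b τ α C)) →
            X.IsStreaming a b τ ∧
            X.rate = ((τ : ℚ) + 1 - a) / ((τ : ℚ) + 1 - a + b) ∧
            X.HasOptimalRate a b τ := by
  refine ⟨exists_allMinorsNonzero ha (by omega), fun α C hα hC => ?_⟩
  have hkn : τ + 1 - a ≤ τ + 1 + (b - a) := by omega
  have hB1 : PropB1 a b τ (codeOfParityCheck (parityCheck a b τ α C)) :=
    propB1_parityCheck hα hbτ
  have hR1 := propR1_parityCheck hα hC ha hab hbτ
  have hB2 := propB2_parityCheck hα hC ha hab hbτ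
  have hR2 := propR2_parityCheck hα hC ha hab hbτ
  -- the last `b` symbols form a burst as in `PropB2`, so the first `τ + 1 - a` are systematic
  have hinj : ∀ d ∈ codeOfParityCheck (parityCheck a b τ α C),
      (∀ i : Fin (τ + 1 - a), d (Fin.castLE hkn i) = 0) → d = 0 := by
    intro d hd h
    funext j
    by_cases hj : j.val < τ + 1 - a
    · exact h ⟨j, hj⟩
    · refine recoverable_iff.1 (hB2 (τ + 1 - a) (by omega) le_rfl j (by omega) (by omega)) d hd
        fun i hi => ?_
      simp only [Set.mem_ofPred_eq] at hi
      exact h ⟨i, by omega⟩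
  have hdim : τ + 1 - a ≤ Module.finrank K (codeOfParityCheck (parityCheck a b τ α C)) := by
    have := le_finrank_codeOfParityCheck (parityCheck a b τ α C)
    omega
  have hrate : ∀ X : PacketCode K (τ + 1 - a) (τ + 1 + (b - a)),
      X.rate = ((τ + 1 - a : ℕ) : ℚ) / ((τ + 1 - a + b : ℕ) : ℚ) := by
    intro X
    rw [PacketCode.rate, show τ + 1 + (b - a) = τ + 1 - a + b by omega]
  refine ⟨(exists_systematic_encoder hkn _ hinj hdim).1, hB1, hR1, hB2, hR2,
    existsUnique_isDiagonalEmbedding hkn _ hinj hdim, fun X hX => ⟨?_, ?_, ?_⟩⟩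
  · exact hX.isStreaming ha hab hbτ hB1 hR1 hB2 hR2
  · rw [hrate, Nat.cast_add, Nat.cast_sub (by omega)]
    push_cast
    rfl
  · intro L _ _ k' n' Y hY
    rw [hrate]
    exact hY.rate_le hab hbτ
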